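/- \textbf{Theorem (higher Stirling formula).} Let $D=\mathbb C\setminus\{0,-1,-2,\dots\}$. There is a unique sequence of holomorphic functions $G_n:D\to\mathbb C$ $(n\ge 0)$ such that $G_0(z)=z$, $G_n(1)=1$, $G_{n+1}(z+1)=G_n(z)\,G_{n+1}(z)$ for $z\in D$, and, for all real $x\ge 0$, $G_n(x+1)$ is a positive real number and $\frac{d^{n+1}}{dx^{n+1}}\log G_n(x+1)\ge 0$ (the Vignéras multiple gamma functions). Let $n\ge1$. On $\mathbb C\setminus(-\infty,-1]$ let $\log G_n(z+1)$ be the holomorphic branch vanishing at $z=0$ (in particular this branch exists), and let $\log(z+1)$ be the principal branch. Let $B_r$ be the Bernoulli numbers ($\frac{z}{e^z-1}=\sum_r B_r z^r/r!$), $\overline B_m(t)=B_m(t-\lfloor t\rfloor)$ the periodic Bernoulli functions, $\zeta$ the Riemann zeta function, $\binom{x}{k}=x(x-1)\cdots(x-k+1)/k!$, define $G_{n,j}(z)$ by $\binom{z-u}{n-1}=\sum_{j=0}^{n-1}G_{n,j}(z)u^j$, and put $$F_{n,k}(z)=\Big(\frac{d}{dt}\Big)^{k}\Big\{\binom{-t}{n-1}\log\frac{z+t}{z+1}\Big\}\Big|_{t=1},\qquad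 R_{n,m}(z)=\frac{(-1)^{m-1}}{m!}\int_1^\infty \overline B_m(t)\Big(\frac{d}{dt}\Big)^{m}\Big\{\binom{-t}{n-1}\log\frac{z+t}{z+1}\Big\}dt .$$ Let $0<\delta<\pi$. As $|z|\to\infty$ in the sector $|\arg z|<\pi-\delta$, $$\begin{aligned}\log G_n(z+1)\sim{}&\Big\{\binom{z+1}{n}+\sum_{r=1}^{n}\frac{B_r}{r!}\Big(-\frac{d}{dz}\Big)^{r-1}\binom{z}{n-1}\Big\}\log(z+1)\\ &-\sum_{r=1}^{n}\Big\{\Big(-\frac{d}{dz}\Big)^{r-1}\binom{z}{n-1}\Big\}\frac{(z+1)^r-1}{r!\,r}\\ &-\sum_{j=0}^{n-1}G_{n,j}(z)\Big\{\zeta'(-j)+\frac1{(j+1)^2}\Big\} +\sum_{r=1}^{\infty}\frac{B_{2r}}{(2r)!}F_{n,2r-1}(z),\end{aligned}$$ in the sense that for every $M\ge0$ the difference between the left side and the right side with the series truncated after $r=M$ is $O(|z|^{n-2M-2})$. Moreover, as $|z|\to\infty$ in the sector, $F_{n,r-1}(z)=O(|z|^{n-r})$ for every $r\ge1$, and for every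 $m>n$ the integral defining $R_{n,m}(z)$ converges absolutely for all $z$ in the sector and $R_{n,m}(z)=O(|z|^{n-m+1})$. The implied constants depend only on $n,\delta$ and on $M$, $r$ or $m$ respectively. -/

import Mathlib

open Filter Asymptotics

noncomputable section

/-- The domain `ℂ ∖ {0, -1, -2, …}` on which the multiple gamma functions are holomorphic. -/
def gammaDomain : Set ℂ := {z : ℂ | ∀ k : ℕ, z ≠ -(k : ℂ)}

/-- The generalized Bohr-Mollerup conditions on a hierarchy of functions `G₀, G₁, G₂, …`.
The fourth condition says that the restriction of `Gₙ` to `[1, ∞)` is real and positive, so that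
its logarithm makes sense, and the fifth that
`(d/dx)^(n+1) log Gₙ(x+1) ≥ 0` for all real `x ≥ 0`. -/
structure IsMultipleGammaHierarchy (G : ℕ → ℂ → ℂ) : Prop where
  holomorphic : ∀ n : ℕ, DifferentiableOn ℂ (G n) gammaDomain
  zero_eq : ∀ z ∈ gammaDomain, G 0 z = z
  one_eq : ∀ n : ℕ, G n 1 = 1
  functional_eq : ∀ n : ℕ, ∀ z ∈ gammaDomain, G (n + 1) (z + 1) = G n z * G (n + 1) z
  real_pos : ∀ n : ℕ, ∀ x : ℝ, 0 ≤ x →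
    (G n ((x : ℂ) + 1)).im = 0 ∧ 0 < (G n ((x : ℂ) + 1)).re
  deriv_log_nonneg : ∀ n : ℕ, ∀ x : ℝ, 0 ≤ x →
    0 ≤ iteratedDeriv (n + 1) (fun y : ℝ => Real.log (G n ((y : ℂ) + 1)).re) x

/-- The Vignéras multiple gamma functions `Gₙ`: the hierarchy that satisfies the generalized
Bohr-Mollerup conditions (its values outside `gammaDomain` are irrelevant). -/
def multipleGamma : ℕ → ℂ → ℂ := Classical.epsilon IsMultipleGammaHierarchy

/-- `L z` is `log Gₙ(z+1)`: the holomorphic branch on the simply connected domain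
`ℂ ∖ (-∞, -1]` that vanishes at `z = 0`. It is uniquely determined there. -/
structure IsLogMultipleGamma (n : ℕ) (L : ℂ → ℂ) : Prop where
  holomorphic : DifferentiableOn ℂ L {z : ℂ | z + 1 ∈ Complex.slitPlane}
  exp_eq : ∀ z : ℂ, z + 1 ∈ Complex.slitPlane → Complex.exp (L z) = multipleGamma n (z + 1)
  zero_eq : L 0 = 0

/-- The sector `|arg z| < π - δ`. -/
def stirlingSector (δ : ℝ) : Set ℂ := {z : ℂ | |Complex.arg z| < Real.pi - δ}

/-- The filter "`|z| → ∞` in the sector `|arg z| < π - δ`". -/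
def sectorAtInfty (δ : ℝ) : Filter ℂ := Bornology.cobounded ℂ ⊓ 𝓟 (stirlingSector δ)

/-- The binomial coefficient `x(x-1)⋯(x-k+1)/k!` as a polynomial in `x`. -/
def binomPoly (k : ℕ) : Polynomial ℂ :=
  Polynomial.C (1 / (k.factorial : ℂ)) * descPochhammer ℂ k

/-- `(-d/dz)^k` applied to the binomial coefficient `z choose (n-1)`. -/
def binomDeriv (n k : ℕ) (z : ℂ) : ℂ :=
  (-1) ^ k * (Polynomial.derivative^[k] (binomPoly (n - 1))).eval z

/-- `G_{n,j}(z)`: the coefficient of `u^j` in `(z - u) choose (n-1)`. -/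
def binomCoeff (n j : ℕ) (z : ℂ) : ℂ :=
  ((binomPoly (n - 1)).comp (Polynomial.C z - Polynomial.X)).coeff j

/-- The function `t ↦ ((-t) choose (n-1)) log ((z+t)/(z+1))` of a real variable. -/
def stirlingKernel (n : ℕ) (z : ℂ) (t : ℝ) : ℂ :=
  (binomPoly (n - 1)).eval (-(t : ℂ)) * Complex.log ((z + (t : ℂ)) / (z + 1))

/-- `F_{n,k}(z)`: the `k`-th derivative of `stirlingKernel n z` at `t = 1`. -/
def stirlingF (n k : ℕ) (z : ℂ) : ℂ := iteratedDeriv k (stirlingKernel n z) 1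

/-- The integrand `B̄ₘ(t) (d/dt)^m stirlingKernel n z t` of the Euler-Maclaurin remainder, with
`B̄ₘ(t) = Bₘ(t - ⌊t⌋)`. -/
def stirlingRIntegrand (n m : ℕ) (z : ℂ) (t : ℝ) : ℂ :=
  (bernoulliFun m (Int.fract t) : ℂ) * iteratedDeriv m (stirlingKernel n z) t

/-- The Euler-Maclaurin remainder `R_{n,m}(z)`; the sign is `(-1)^(m-1) = (-1)^(m+1)`. -/
def stirlingR (n m : ℕ) (z : ℂ) : ℂ :=
  (-1) ^ (m + 1) / (m.factorial : ℂ) * ∫ t in Set.Ioi (1 : ℝ), stirlingRIntegrand n m z t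

/-- The explicit part (logarithmic, polynomial and `ζ'(-j)` terms) of the expansion of
`log Gₙ(z+1)`. -/
def stirlingMain (n : ℕ) (z : ℂ) : ℂ :=
  ((binomPoly n).eval (z + 1)
      + ∑ r ∈ Finset.Icc 1 n,
          (bernoulli r : ℂ) / (r.factorial : ℂ) * binomDeriv n (r - 1) z) * Complex.log (z + 1)
    - ∑ r ∈ Finset.Icc 1 n,
        binomDeriv n (r - 1) z * (1 / ((r.factorial : ℂ) * (r : ℂ)) * ((z + 1) ^ r - 1))
    - ∑ j ∈ Finset.range n,
        binomCoeff n j z * (deriv riemannZeta (-(j : ℂ)) + 1 / ((j : ℂ) + 1) ^ 2)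

end

/-!
Formally, `log Gₙ(z + 1)` is `-∑ C(-k, n - 1) log (z + k)` over `k ≥ 1`, normalized at `z = 0`.
With `u = z + k` the coefficient is `C(z - u, n - 1) = ∑ Gₙⱼ(z) u ^ j`, so the divergent series
regularizes to

  `∑ Gₙⱼ(z) (ζ'(-j, z + 1) - ζ'(-j))`  (sum over `j < n`),

with the derivative in `s` of the Hurwitz zeta function `ζ(s, w)`. This is `logMultipleGamma`.
Instead of the Hurwitz zeta function itself, only its Euler–Maclaurin expression at `s = -j` is
needed (`hurwitzDeriv`): it satisfies `H(w + 1) = H(w) + w ^ j log w`, it does not depend on the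
order of the remainder, because two such expressions differ by a `1`-periodic function that tends
to zero, and at `w = 1` it equals `ζ'(-j)`, because the Euler–Maclaurin formula for `ζ(s)` in
`Re s > 1` continues analytically to the left (`deriv_riemannZeta_neg_natCast`).

*Existence.* Pascal's rule turns the relation for `H` into the functional equation
`log Gₙ₊₁(z + 2) = log Gₙ₊₁(z + 1) + log Gₙ(z + 1)`. Since `log Gₙ(z + 1) = o(|z| ^ (n + 1))` in
sectors, Cauchy's estimate makes all derivatives of order `> n` tend to zero along the positive
axis; their signs then alternate by induction on `n`, since up to sign they decrease along `x + ℕ`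
(`neg_one_pow_mul_iteratedDeriv_logMultipleGamma_nonneg`). The exponential extends from the slit
plane to `ℂ ∖ {0, -1, -2, …}` by dividing by values of `Gₙ`, which has no zeros
(`gammaHierarchy`).

*Uniqueness.* For two hierarchies that agree in level `n`, the difference of the logarithms in
level `n + 1` has a periodic derivative of order `n + 1`, a difference of two monotone functions
whose increments tend to zero. Hence this derivative is constant, and by periodicity so is the
difference itself (`exists_sub_eq_const_of_difference`); the identity theorem does the rest.

*Asymptotics.* Substituting the Euler–Maclaurin expression of order `m > n` gives `log Gₙ(z + 1)`
exactly as the explicit part plus `∑ Bᵣ / r! F_{n,r-1}(z)` over `r ≤ m` minus `R_{n,m}(z)`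
(`logMultipleGamma_eq_main_add`). The coefficient of `log (z + 1)` comes out right by a polynomial
identity, itself an instance of Euler–Maclaurin (`sum_binomCoeff_primitive`). In `F` and `R` the
logarithms cancel, so both are sums of terms `Gₙⱼ(z)` times powers of `z + 1` or integrals of powers
of `z + t`; the bounds follow from `Gₙⱼ(z) = O(|z| ^ (n - 1 - j))` and from
`|z + t| ≥ c (|z| + t)` in the sector.
-/

/-! ### The Euler–Maclaurin formula on unit intervals -/

/-- The Euler–Maclaurin formula on `[0, 1]` for the function `a 1` with primitive `a 0` and
successive derivatives `a 2, a 3, …`. -/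
theorem euler_maclaurin_unit (a : ℕ → ℝ → ℂ)
    (ha : ∀ i, ∀ t ∈ Set.Icc (0 : ℝ) 1, HasDerivAt (a i) (a (i + 1) t) t) (m : ℕ) :
    ∑ r ∈ Finset.range (m + 2), (bernoulli r : ℂ) / (r.factorial : ℂ) * (a r 1 - a r 0)
      = a 1 0 + (-1) ^ (m + 1) / ((m + 1).factorial : ℂ)
          * ∫ t in (0 : ℝ)..1, (bernoulliFun (m + 1) t : ℂ) * a (m + 2) t := by
  have hcont : ∀ i, ContinuousOn (a i) (Set.uIcc (0 : ℝ) 1) := fun i t ht =>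
    (ha i t (by simpa using ht)).continuousAt.continuousWithinAt
  have hB : ∀ k t, HasDerivAt (fun t : ℝ => (bernoulliFun (k + 1) t : ℂ))
      (((k : ℂ) + 1) * (bernoulliFun k t : ℂ)) t := fun k t => by
    have := (hasDerivAt_bernoulliFun (k + 1) t).ofReal_comp
    simpa using this
  -- integration by parts against the Bernoulli polynomial of degree `k + 1`
  have hparts : ∀ k, ∫ t in (0 : ℝ)..1, (bernoulliFun (k + 1) t : ℂ) * a (k + 2) t
      = (bernoulliFun (k + 1) 1 : ℂ) * a (k + 1) 1 - (bernoulliFun (k + 1) 0 : ℂ) * a (k + 1) 0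
        - ((k : ℂ) + 1) * ∫ t in (0 : ℝ)..1, (bernoulliFun k t : ℂ) * a (k + 1) t := by
    intro k
    rw [intervalIntegral.integral_mul_deriv_eq_deriv_mul 
      (u := fun t : ℝ => (bernoulliFun (k + 1) t : ℂ))
      (v := a (k + 1)) (u' := fun t : ℝ => ((k : ℂ) + 1) * (bernoulliFun k t : ℂ))
      (v' := a (k + 2)) (fun t _ => hB k t) (fun t ht => ha (k + 1) t (by simpa using ht))
      (Continuous.intervalIntegrable (by fun_prop) _ _) ((hcont _).intervalIntegrable)]
    simp only [mul_assoc]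
    rw [intervalIntegral.integral_const_mul]
  have h0 : ∫ t in (0 : ℝ)..1, (bernoulliFun 0 t : ℂ) * a 1 t = a 0 1 - a 0 0 := by
    simp only [bernoulliFun_zero, Complex.ofReal_one, one_mul]
    exact intervalIntegral.integral_eq_sub_of_hasDerivAt (fun t ht => ha 0 t (by simpa using ht))
      ((hcont 1).intervalIntegrable)
  induction m with
  | zero =>
    rw [hparts 0, h0]
    simp [Finset.sum_range_succ]
    ring
  | succ m ih =>
    rw [Finset.sum_range_succ, ih, hparts (m + 1),
      bernoulliFun_endpoints_eq_of_ne_one (by omega : m + 1 + 1 ≠ 1), bernoulliFun_eval_zero]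
    have h1 : ((m + 1 + 1).factorial : ℂ) = ((m : ℂ) + 1 + 1) * ((m + 1).factorial : ℂ) := by
      rw [Nat.factorial_succ]; push_cast; ring
    have h2 : ((m + 1).factorial : ℂ) ≠ 0 := by exact_mod_cast Nat.factorial_ne_zero _
    have h3 : ((m : ℂ) + 1 + 1) ≠ 0 := by exact_mod_cast Nat.succ_ne_zero (m + 1)
    have h4 : ((-1 : ℂ)) ^ (m + 1 + 1) * (bernoulli (m + 1 + 1) : ℂ)
        = (bernoulli (m + 1 + 1) : ℂ) := by
      rcases Nat.even_or_odd (m + 1 + 1) with h | h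
      · simp [h.neg_one_pow]
      · rw [bernoulli_eq_zero_of_odd h (by omega)]; simp
    rw [h1]
    push_cast
    field_simp
    linear_combination (-(a (m + 1 + 1) 1 - a (m + 1 + 1) 0)) * h4

theorem bernoulliFun_fract_bounded (m : ℕ) :
    ∃ C : ℝ, 0 < C ∧ ∀ t : ℝ, ‖(bernoulliFun m (Int.fract t) : ℂ)‖ ≤ C := by
  obtain ⟨C, hC⟩ := (isCompact_Icc (a := (0 : ℝ)) (b := 1)).exists_bound_of_continuousOn
    (continuous_bernoulliFun m).continuousOn
  refine ⟨max C 1, by positivity, fun t => ?_⟩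
  rw [Complex.norm_real]
  exact (hC _ ⟨Int.fract_nonneg t, (Int.fract_lt_one t).le⟩).trans (le_max_left _ _)

theorem measurable_bernoulliFun_fract (m : ℕ) :
    Measurable fun t : ℝ => (bernoulliFun m (Int.fract t) : ℂ) :=
  Complex.measurable_ofReal.comp ((continuous_bernoulliFun m).measurable.comp measurable_fract)

theorem intervalIntegral_bernoulliFun_fract (m : ℕ) (k : ℕ) (f : ℝ → ℂ) :
    ∫ t in (k : ℝ)..(k + 1), (bernoulliFun m (Int.fract t) : ℂ) * f t
      = ∫ t in (0 : ℝ)..1, (bernoulliFun m t : ℂ) * f (k + t) := by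
  have h := intervalIntegral.integral_comp_add_left
    (fun t => (bernoulliFun m (Int.fract t) : ℂ) * f t) (k : ℝ) (a := 0) (b := 1)
  rw [add_zero] at h
  rw [← h]
  refine intervalIntegral.integral_congr_ae ?_
  have : ∀ᵐ t : ℝ, t ≠ 1 := by simp [MeasureTheory.ae_iff]
  filter_upwards [this] with t ht hmem
  rw [Set.uIoc_of_le zero_le_one] at hmem
  rw [Int.fract_natCast_add, Int.fract_eq_self.2 ⟨hmem.1.le, lt_of_le_of_ne hmem.2 ht⟩]

theorem euler_maclaurin_nat (a : ℕ → ℝ → ℂ)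
    (ha : ∀ i, ∀ t : ℝ, 0 ≤ t → HasDerivAt (a i) (a (i + 1) t) t) (m N : ℕ) :
    ∑ r ∈ Finset.range (m + 2), (bernoulli r : ℂ) / (r.factorial : ℂ) * (a r N - a r 0)
      = ∑ k ∈ Finset.range N, a 1 k + (-1) ^ (m + 1) / ((m + 1).factorial : ℂ)
          * ∫ t in (0 : ℝ)..N, (bernoulliFun (m + 1) (Int.fract t) : ℂ) * a (m + 2) t := by
  have hint : ∀ x y : ℝ, 0 ≤ x → 0 ≤ y → IntervalIntegrable
      (fun t => (bernoulliFun (m + 1) (Int.fract t) : ℂ) * a (m + 2) t)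
      MeasureTheory.volume x y := by
    intro x y hx hy
    obtain ⟨C, -, hC⟩ := bernoulliFun_fract_bounded (m + 1)
    have hc : IntervalIntegrable (a (m + 2)) MeasureTheory.volume x y :=
      ContinuousOn.intervalIntegrable fun t ht =>
        (ha _ t ((le_min hx hy).trans ht.1)).continuousAt.continuousWithinAt
    exact ⟨hc.1.bdd_mul (measurable_bernoulliFun_fract _).aestronglyMeasurable
      (Eventually.of_forall hC), hc.2.bdd_mul (measurable_bernoulliFun_fract _).aestronglyMeasurable
      (Eventually.of_forall hC)⟩
  induction N with
  | zero => simp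
  | succ N ih =>
    have h1 := euler_maclaurin_unit (fun i t => a i (N + t)) (fun i t ht => by
      simpa using (ha i (N + t) (by have := ht.1; positivity)).comp_const_add (N : ℝ) t) m
    rw [← intervalIntegral_bernoulliFun_fract (m + 1) N (a (m + 2))] at h1
    rw [Finset.sum_range_succ _ N]
    push_cast
    rw [← intervalIntegral.integral_add_adjacent_intervals (hint 0 N le_rfl (by positivity))
      (hint N (N + 1) (by positivity) (by positivity)), mul_add]
    simp only [add_zero] at h1
    calc _ = ∑ r ∈ Finset.range (m + 2), (bernoulli r : ℂ) / (r.factorial : ℂ) * (a r N - a r 0)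
        + ∑ r ∈ Finset.range (m + 2), (bernoulli r : ℂ) / (r.factorial : ℂ)
          * (a r (N + 1) - a r N) := by
          rw [← Finset.sum_add_distrib]; exact Finset.sum_congr rfl fun r _ => by ring
      _ = _ := by rw [ih, h1]; ring

/-! ### The functions `w ^ j * log w` and their derivatives -/

/-- The derivatives of `w ^ j * log w`, starting from a primitive: index `0` is the primitive
`w ^ (j + 1) * (log w / (j + 1) - 1 / (j + 1) ^ 2)` and index `i + 1` is the `i`-th derivative,
written with the falling factorial `q` of degree `i` as `w ^ (j - i) * (q j * log w + q' j)`. -/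
noncomputable def powLogSeq (j : ℕ) : ℕ → ℂ → ℂ
  | 0 => fun w => w ^ (j + 1) * (Complex.log w / ((j : ℂ) + 1) - 1 / ((j : ℂ) + 1) ^ 2)
  | i + 1 => fun w => w ^ ((j : ℤ) - i) * ((descPochhammer ℂ i).eval (j : ℂ) * Complex.log w
      + (Polynomial.derivative (descPochhammer ℂ i)).eval (j : ℂ))

theorem descPochhammer_eval_natCast_eq_zero {i j : ℕ} (h : j < i) :
    (descPochhammer ℂ i).eval (j : ℂ) = 0 := by
  induction i with
  | zero => omega
  | succ i ih =>
    rw [descPochhammer_succ_eval]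
    rcases (Nat.lt_succ_iff.1 h).lt_or_eq with h | h
    · rw [ih h, zero_mul]
    · rw [h, sub_self, mul_zero]

theorem powLogSeq_one (j : ℕ) (w : ℂ) : powLogSeq j 1 w = w ^ j * Complex.log w := by
  simp [powLogSeq]

theorem powLogSeq_of_lt {i j : ℕ} (h : j < i) (w : ℂ) :
    powLogSeq j (i + 1) w
      = (Polynomial.derivative (descPochhammer ℂ i)).eval (j : ℂ) * (w ^ (i - j))⁻¹ := by
  have : (j : ℤ) - i = -((i - j : ℕ) : ℤ) := by push_cast [h.le]; ring
  simp only [powLogSeq, descPochhammer_eval_natCast_eq_zero h, this, zpow_neg, zpow_natCast]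
  ring

theorem hasDerivAt_powLogSeq (j i : ℕ) {w : ℂ} (hw : w ∈ Complex.slitPlane) :
    HasDerivAt (powLogSeq j i) (powLogSeq j (i + 1) w) w := by
  have hw0 : w ≠ 0 := Complex.slitPlane_ne_zero hw
  have hj : (j : ℂ) + 1 ≠ 0 := by exact_mod_cast Nat.succ_ne_zero j
  have hlog := Complex.hasDerivAt_log hw
  cases i with
  | zero =>
    have h := (hasDerivAt_pow (j + 1) w).mul
      ((hlog.div_const ((j : ℂ) + 1)).sub_const (1 / ((j : ℂ) + 1) ^ 2))
    refine h.congr_deriv ?_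
    simp only [powLogSeq]
    simp
    field_simp
    ring
  | succ i =>
    have h := (hasDerivAt_zpow ((j : ℤ) - i) w (Or.inl hw0)).mul
      ((hlog.const_mul ((descPochhammer ℂ i).eval (j : ℂ))).add_const
        ((Polynomial.derivative (descPochhammer ℂ i)).eval (j : ℂ)))
    refine h.congr_deriv ?_
    have hz : w ^ ((j : ℤ) - i) = w ^ ((j : ℤ) - i - 1) * w := by
      rw [← zpow_add_one₀ hw0]; ring_nf
    have hz' : (j : ℤ) - (i + 1 : ℕ) = j - i - 1 := by push_cast; ring
    simp only [powLogSeq]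
    rw [hz, hz', descPochhammer_succ_right]
    simp
    field_simp
    ring

theorem add_ofReal_mem_slitPlane {w : ℂ} (hw : w ∈ Complex.slitPlane) {t : ℝ} (ht : 0 ≤ t) :
    w + t ∈ Complex.slitPlane := by
  rw [Complex.mem_slitPlane_iff] at *
  rcases hw with h | h
  · left; simp; linarith
  · right; simpa using h

theorem integral_Ioi_comp_add_left {E : Type*} [NormedAddCommGroup E] [NormedSpace ℝ E]
    (f : ℝ → E) (a d : ℝ) :
    ∫ t in Set.Ioi a, f (d + t) = ∫ t in Set.Ioi (d + a), f t := by
  have := (MeasureTheory.measurePreserving_add_left MeasureTheory.volume d).setIntegral_preimage_emb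
    (MeasurableEquiv.addLeft d).measurableEmbedding f (Set.Ioi (d + a))
  rw [← this]
  simp

theorem integrableOn_Ioi_comp_add_left {E : Type*} [NormedAddCommGroup E]
    (f : ℝ → E) (a d : ℝ) :
    MeasureTheory.IntegrableOn (fun t => f (d + t)) (Set.Ioi a)
      ↔ MeasureTheory.IntegrableOn f (Set.Ioi (d + a)) := by
  have :=
    (MeasureTheory.measurePreserving_add_left MeasureTheory.volume d).integrableOn_comp_preimage
    (MeasurableEquiv.addLeft d).measurableEmbedding (f := f) (s := Set.Ioi (d + a))
  rw [← this]
  simp [Function.comp_def]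

/-! ### Integrals against periodic Bernoulli functions -/

/-- A ray `z + [0, ∞)` recedes from the origin linearly in `‖z‖ + t`, with a rate that depends
only on how far the direction of `z` stays from the negative real axis. -/
theorem sqrt_mul_le_norm_add_ofReal {a : ℝ} (ha : -1 ≤ a) {z : ℂ} (hz : -a * ‖z‖ ≤ z.re)
    {t : ℝ} (ht : 0 ≤ t) : √((1 - a) / 2) * (‖z‖ + t) ≤ ‖z + t‖ := by
  rcases le_total ((1 - a) / 2) 0 with h | h
  · rw [Real.sqrt_eq_zero_of_nonpos h, zero_mul]; exact norm_nonneg _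
  have h2 : ‖z + t‖ ^ 2 = ‖z‖ ^ 2 + t ^ 2 + 2 * t * z.re := by
    rw [← Complex.normSq_eq_norm_sq, ← Complex.normSq_eq_norm_sq, Complex.normSq_apply,
      Complex.normSq_apply]
    simp
    ring
  refine (sq_le_sq₀ (by positivity) (norm_nonneg _)).1 ?_
  rw [mul_pow, Real.sq_sqrt h, h2]
  nlinarith [mul_le_mul_of_nonneg_left hz ht, mul_nonneg (by linarith : 0 ≤ 1 + a)
    (sq_nonneg (‖z‖ - t))]

theorem exists_mul_le_norm_add_ofReal {w : ℂ} (hw : w ∈ Complex.slitPlane) :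
    ∃ c : ℝ, 0 < c ∧ ∀ t : ℝ, 0 ≤ t → c * (‖w‖ + t) ≤ ‖w + t‖ := by
  have hn : 0 < ‖w‖ := norm_pos_iff.2 (Complex.slitPlane_ne_zero hw)
  have h1 : -‖w‖ < w.re := by
    rcases (Complex.mem_slitPlane_iff.1 hw) with h | h
    · linarith
    · exact (abs_lt.1 (Complex.abs_re_lt_norm.2 h)).1
  have h2 : w.re ≤ ‖w‖ := Complex.re_le_norm w
  refine ⟨√((1 - -(w.re / ‖w‖)) / 2), Real.sqrt_pos.2 ?_, fun t ht =>
    sqrt_mul_le_norm_add_ofReal ?_ ?_ ht⟩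
  · have : -1 < w.re / ‖w‖ := by rw [lt_div_iff₀ hn]; linarith
    linarith
  · have : w.re / ‖w‖ ≤ 1 := by rw [div_le_iff₀ hn]; linarith
    linarith
  · rw [neg_neg, div_mul_cancel₀ _ hn.ne']

/-- The integral over `(0, ∞)` of the periodic Bernoulli function of degree `m` against
`(w + t) ^ (-k)`. -/
noncomputable def bernoulliIntegral (m k : ℕ) (w : ℂ) : ℂ :=
  ∫ t in Set.Ioi (0 : ℝ), (bernoulliFun m (Int.fract t) : ℂ) * ((w + (t : ℂ)) ^ k)⁻¹

theorem integrableOn_inv_add_pow {a : ℝ} (ha : 0 < a) (k : ℕ) :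
    MeasureTheory.IntegrableOn (fun t : ℝ => ((a + t) ^ (k + 2))⁻¹) (Set.Ioi 0) := by
  have := integrableOn_add_rpow_Ioi_of_lt (a := -((k + 2 : ℕ) : ℝ)) (c := 0) (m := a)
    (by push_cast; linarith [(Nat.cast_nonneg k : (0 : ℝ) ≤ k)]) (by linarith)
  refine this.congr_fun (fun t ht => ?_) measurableSet_Ioi
  have ht : 0 < t := ht
  show (t + a) ^ (-((k + 2 : ℕ) : ℝ)) = _
  rw [Real.rpow_neg (by positivity), Real.rpow_natCast, add_comm]

theorem integral_inv_add_pow_le {a : ℝ} (ha : 0 < a) (k : ℕ) :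
    ∫ t in Set.Ioi (0 : ℝ), ((a + t) ^ (k + 2))⁻¹ ≤ (a ^ (k + 1))⁻¹ := by
  have h1 : ∫ t in Set.Ioi (0 : ℝ), ((a + t) ^ (k + 2))⁻¹
      = ∫ t in Set.Ioi a, t ^ (-((k + 2 : ℕ) : ℝ)) := by
    have := integral_Ioi_comp_add_left (fun t : ℝ => t ^ (-((k + 2 : ℕ) : ℝ))) 0 a
    rw [add_zero] at this
    rw [← this]
    refine MeasureTheory.setIntegral_congr_fun measurableSet_Ioi (fun t ht => ?_)
    have ht : 0 < t := ht
    show _ = (a + t) ^ (-((k + 2 : ℕ) : ℝ))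
    rw [Real.rpow_neg (by positivity), Real.rpow_natCast]
  have hk : (0 : ℝ) ≤ k := Nat.cast_nonneg k
  rw [h1, integral_Ioi_rpow_of_lt (by push_cast; linarith) ha]
  have h2 : -((k + 2 : ℕ) : ℝ) + 1 = -((k + 1 : ℕ) : ℝ) := by push_cast; ring
  rw [h2, Real.rpow_neg ha.le, Real.rpow_natCast, neg_div_neg_eq]
  refine div_le_self (by positivity) (by push_cast; linarith)

theorem norm_bernoulliFun_mul_inv_le {m k : ℕ} {C c a : ℝ} {w : ℂ} (hC0 : 0 < C) (hc : 0 < c)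
    (ha : 0 < a) (hC : ∀ t : ℝ, ‖(bernoulliFun m (Int.fract t) : ℂ)‖ ≤ C)
    {t : ℝ} (ht : 0 ≤ t) (hw : c * (a + t) ≤ ‖w + t‖) :
    ‖(bernoulliFun m (Int.fract t) : ℂ) * ((w + (t : ℂ)) ^ k)⁻¹‖ ≤ C / c ^ k * ((a + t) ^ k)⁻¹ := by
  rw [norm_mul, norm_inv, norm_pow, ← div_eq_mul_inv, ← div_eq_mul_inv, div_div, ← mul_pow]
  have : 0 < c * (a + t) := by positivity
  exact div_le_div₀ hC0.le (hC t) (by positivity) (pow_le_pow_left₀ this.le hw k)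

theorem measurable_bernoulliFun_mul_inv (m k : ℕ) (w : ℂ) :
    Measurable fun t : ℝ => (bernoulliFun m (Int.fract t) : ℂ) * ((w + (t : ℂ)) ^ k)⁻¹ := by
  have := measurable_bernoulliFun_fract m
  fun_prop

theorem integrableOn_bernoulliFun_mul_inv (m k : ℕ) {c a : ℝ} {w : ℂ} (hc : 0 < c) (ha : 0 < a)
    (hw : ∀ t : ℝ, 0 ≤ t → c * (a + t) ≤ ‖w + t‖) :
    MeasureTheory.IntegrableOn (fun t : ℝ => (bernoulliFun m (Int.fract t) : ℂ)
      * ((w + (t : ℂ)) ^ (k + 2))⁻¹) (Set.Ioi 0) := by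
  obtain ⟨C, hC0, hC⟩ := bernoulliFun_fract_bounded m
  refine MeasureTheory.Integrable.mono'
    ((integrableOn_inv_add_pow ha k).const_mul (C / c ^ (k + 2)))
    (measurable_bernoulliFun_mul_inv m _ w).aestronglyMeasurable ?_
  filter_upwards [MeasureTheory.ae_restrict_mem measurableSet_Ioi] with t ht
  exact norm_bernoulliFun_mul_inv_le hC0 hc ha hC (le_of_lt ht) (hw t (le_of_lt ht))

theorem exists_norm_bernoulliIntegral_le (m k : ℕ) {c : ℝ} (hc : 0 < c) :
    ∃ K : ℝ, 0 < K ∧ ∀ (a : ℝ) (w : ℂ), 0 < a → (∀ t : ℝ, 0 ≤ t → c * (a + t) ≤ ‖w + t‖) →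
      ‖bernoulliIntegral m (k + 2) w‖ ≤ K * (a ^ (k + 1))⁻¹ := by
  obtain ⟨C, hC0, hC⟩ := bernoulliFun_fract_bounded m
  refine ⟨C / c ^ (k + 2), by positivity, fun a w ha hw => ?_⟩
  refine (MeasureTheory.norm_integral_le_of_norm_le
    ((integrableOn_inv_add_pow ha k).const_mul (C / c ^ (k + 2))) ?_).trans ?_
  · filter_upwards [MeasureTheory.ae_restrict_mem measurableSet_Ioi] with t ht
    exact norm_bernoulliFun_mul_inv_le hC0 hc ha hC (le_of_lt ht) (hw t (le_of_lt ht))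
  · rw [MeasureTheory.integral_const_mul]
    exact mul_le_mul_of_nonneg_left (integral_inv_add_pow_le ha k) (by positivity)

theorem differentiableAt_bernoulliIntegral (m k : ℕ) {w : ℂ} (hw : w ∈ Complex.slitPlane) :
    DifferentiableAt ℂ (bernoulliIntegral m (k + 2)) w := by
  obtain ⟨C, hC0, hC⟩ := bernoulliFun_fract_bounded m
  obtain ⟨c, hc, hcw⟩ := exists_mul_le_norm_add_ofReal hw
  have ha : 0 < ‖w‖ := norm_pos_iff.2 (Complex.slitPlane_ne_zero hw)
  -- the linear lower bound survives, with half the rate, in a neighbourhood of `w`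
  have hnear : ∀ w' ∈ Metric.ball w (c / 2 * ‖w‖), ∀ t : ℝ, 0 ≤ t →
      c / 2 * (‖w‖ + t) ≤ ‖w' + t‖ := by
    intro w' hw' t ht
    rw [Metric.mem_ball, dist_eq_norm] at hw'
    have h1 : ‖w + t‖ ≤ ‖w' + t‖ + ‖w' - w‖ := by
      have := norm_sub_le (w' + t) (w' - w)
      rwa [show w' + t - (w' - w) = w + t by ring] at this
    have := hcw t ht
    nlinarith [mul_nonneg hc.le ht]
  refine (hasDerivAt_integral_of_dominated_loc_of_deriv_le
    (μ := MeasureTheory.volume.restrict (Set.Ioi (0 : ℝ)))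
    (F := fun w (t : ℝ) => (bernoulliFun m (Int.fract t) : ℂ) * ((w + (t : ℂ)) ^ (k + 2))⁻¹)
    (F' := fun w (t : ℝ) => -((k : ℂ) + 2) * ((bernoulliFun m (Int.fract t) : ℂ)
      * ((w + (t : ℂ)) ^ (k + 1 + 2))⁻¹))
    (bound := fun t => ((k : ℝ) + 2) * (C / (c / 2) ^ (k + 1 + 2) * ((‖w‖ + t) ^ (k + 1 + 2))⁻¹))
    (Metric.ball_mem_nhds w (ε := c / 2 * ‖w‖) (by positivity))
    ?_ ?_ ?_ ?_ ?_ ?_).2.differentiableAt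
  · exact Eventually.of_forall fun w' =>
      (measurable_bernoulliFun_mul_inv m _ w').aestronglyMeasurable
  · exact integrableOn_bernoulliFun_mul_inv m k hc ha hcw
  · exact ((measurable_bernoulliFun_mul_inv m _ w).const_mul _).aestronglyMeasurable
  · filter_upwards [MeasureTheory.ae_restrict_mem measurableSet_Ioi] with t ht w' hw'
    rw [norm_mul]
    refine mul_le_mul (le_of_eq ?_) (norm_bernoulliFun_mul_inv_le hC0 (by positivity) ha hC
      (le_of_lt ht) (hnear w' hw' t (le_of_lt ht))) (norm_nonneg _) (by positivity)
    rw [norm_neg]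
    exact_mod_cast Complex.norm_natCast (k + 2)
  · exact (((integrableOn_inv_add_pow ha (k + 1)).const_mul _).const_mul _)
  · filter_upwards [MeasureTheory.ae_restrict_mem measurableSet_Ioi] with t ht w' hw'
    have ht : 0 < t := ht
    have h0 : w' + (t : ℂ) ≠ 0 := by
      rw [← norm_pos_iff]
      exact lt_of_lt_of_le (by positivity) (hnear w' hw' t ht.le)
    have h := ((((hasDerivAt_id w').add_const (t : ℂ)).pow (k + 2)).inv
      (pow_ne_zero _ h0)).const_mul (bernoulliFun m (Int.fract t) : ℂ)
    refine h.congr_deriv ?_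
    simp
    field_simp
    ring

theorem bernoulliIntegral_add_one (m k : ℕ) {w : ℂ} (hw : w ∈ Complex.slitPlane) :
    bernoulliIntegral m (k + 2) w = bernoulliIntegral m (k + 2) (w + 1)
      + ∫ t in (0 : ℝ)..1, (bernoulliFun m t : ℂ) * ((w + (t : ℂ)) ^ (k + 2))⁻¹ := by
  obtain ⟨c, hc, hcw⟩ := exists_mul_le_norm_add_ofReal hw
  have ha : 0 < ‖w‖ := norm_pos_iff.2 (Complex.slitPlane_ne_zero hw)
  have hint := integrableOn_bernoulliFun_mul_inv m k hc ha hcw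
  have h1 : bernoulliIntegral m (k + 2) (w + 1) = ∫ t in Set.Ioi (1 : ℝ),
      (bernoulliFun m (Int.fract t) : ℂ) * ((w + (t : ℂ)) ^ (k + 2))⁻¹ := by
    have := integral_Ioi_comp_add_left (fun t : ℝ =>
      (bernoulliFun m (Int.fract t) : ℂ) * ((w + (t : ℂ)) ^ (k + 2))⁻¹) 0 1
    rw [add_zero] at this
    rw [← this, bernoulliIntegral]
    simp only [Int.fract_one_add, Complex.ofReal_add, Complex.ofReal_one, add_assoc]
  have h2 := intervalIntegral_bernoulliFun_fract m 0 fun t => ((w + (t : ℂ)) ^ (k + 2))⁻¹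
  simp only [Nat.cast_zero, zero_add] at h2
  rw [h1, ← h2, add_comm (∫ t in Set.Ioi (1 : ℝ), _), bernoulliIntegral]
  exact (intervalIntegral.integral_interval_add_Ioi hint
    (hint.mono_set (Set.Ioi_subset_Ioi zero_le_one))).symm

/-! ### The derivative of the Hurwitz zeta function at nonpositive integers -/

/-- The Euler–Maclaurin expression, with remainder of order `m`, for the derivative in `s` at
`s = -j` of the Hurwitz zeta function `∑ (w + k) ^ (-s)`. It does not depend on `m` as soon as
`j + 2 ≤ m`. -/
noncomputable def hurwitzDeriv (j m : ℕ) (w : ℂ) : ℂ :=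
  ∑ r ∈ Finset.range (m + 1), (bernoulli r : ℂ) / (r.factorial : ℂ) * powLogSeq j r w
    + (-1) ^ m / (m.factorial : ℂ) * ((Polynomial.derivative (descPochhammer ℂ m)).eval (j : ℂ)
      * bernoulliIntegral m (m - j) w)

/-- The Euler–Maclaurin formula on `[0, 1]` for `t ↦ (w + t) ^ j * log (w + t)`. -/
theorem hurwitzDeriv_add_one {j m : ℕ} (hm : j + 2 ≤ m) {w : ℂ} (hw : w ∈ Complex.slitPlane) :
    hurwitzDeriv j m (w + 1) = hurwitzDeriv j m w + w ^ j * Complex.log w := by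
  obtain ⟨k, rfl⟩ := Nat.exists_eq_add_of_le hm
  have hEM := euler_maclaurin_unit (fun i t => powLogSeq j i (w + t)) (fun i t ht => by
    simpa using ((hasDerivAt_powLogSeq j i (add_ofReal_mem_slitPlane hw ht.1)).comp_const_add
      w (t : ℂ)).comp_ofReal) (j + 1 + k)
  have hsub : j + 2 + k - j = k + 2 := by omega
  have hI : ∫ t in (0 : ℝ)..1, (bernoulliFun (j + 2 + k) t : ℂ)
        * powLogSeq j (j + 2 + k + 1) (w + t)
      = (Polynomial.derivative (descPochhammer ℂ (j + 2 + k))).eval (j : ℂ)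
        * ∫ t in (0 : ℝ)..1, (bernoulliFun (j + 2 + k) t : ℂ) * ((w + (t : ℂ)) ^ (k + 2))⁻¹ := by
    rw [← intervalIntegral.integral_const_mul]
    refine intervalIntegral.integral_congr fun t _ => ?_
    simp only [powLogSeq_of_lt (show j < j + 2 + k by omega), hsub]
    ring
  rw [show j + 1 + k + 1 = j + 2 + k by ring, show j + 1 + k + 2 = j + 2 + k + 1 by ring, hI] at hEM
  simp only [Complex.ofReal_one, Complex.ofReal_zero, add_zero, mul_sub,
    Finset.sum_sub_distrib, powLogSeq_one] at hEM
  have hJ := bernoulliIntegral_add_one (j + 2 + k) k hw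
  simp only [hurwitzDeriv, hsub]
  rw [hJ]
  linear_combination hEM

theorem differentiableOn_hurwitzDeriv {j m : ℕ} (hm : j + 2 ≤ m) :
    DifferentiableOn ℂ (hurwitzDeriv j m) Complex.slitPlane := by
  intro w hw
  obtain ⟨k, hk⟩ : ∃ k, m - j = k + 2 := ⟨m - j - 2, by omega⟩
  have h := differentiableAt_bernoulliIntegral m k hw
  rw [← hk] at h
  refine DifferentiableAt.differentiableWithinAt ?_
  refine DifferentiableAt.add (DifferentiableAt.fun_sum fun r _ => ?_) ?_
  · exact (hasDerivAt_powLogSeq j r hw).differentiableAt.const_mul _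
  · exact (h.const_mul _).const_mul _

theorem tendsto_bernoulliIntegral_add_natCast (m k : ℕ) {w : ℂ} (hw : w ∈ Complex.slitPlane) :
    Tendsto (fun N : ℕ => bernoulliIntegral m (k + 2) (w + N)) atTop (nhds 0) := by
  obtain ⟨c, hc, hcw⟩ := exists_mul_le_norm_add_ofReal hw
  have ha : 0 < ‖w‖ := norm_pos_iff.2 (Complex.slitPlane_ne_zero hw)
  obtain ⟨K, hK, hb⟩ := exists_norm_bernoulliIntegral_le m k hc
  have hlim : Tendsto (fun N : ℕ => K * ((‖w‖ + (N : ℝ)) ^ (k + 1))⁻¹) atTop (nhds 0) := by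
    rw [← mul_zero K]
    refine Tendsto.const_mul K (tendsto_inv_atTop_zero.comp ?_)
    exact (tendsto_pow_atTop (by omega)).comp
      (tendsto_atTop_add_const_left _ _ tendsto_natCast_atTop_atTop)
  refine squeeze_zero_norm (fun N => hb (‖w‖ + N) (w + N) (by positivity) fun t ht => ?_) hlim
  have := hcw (N + t) (by positivity)
  push_cast at this
  rwa [← add_assoc, ← add_assoc] at this

theorem tendsto_inv_add_natCast_pow (w : ℂ) (k : ℕ) :
    Tendsto (fun N : ℕ => ((w + (N : ℂ)) ^ (k + 1))⁻¹) atTop (nhds 0) := by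
  refine tendsto_inv₀_cobounded.comp ?_
  refine tendsto_norm_atTop_iff_cobounded.1 ?_
  simp only [norm_pow]
  refine (tendsto_pow_atTop (by omega)).comp ?_
  refine tendsto_atTop_mono (fun N : ℕ => ?_)
    (tendsto_atTop_add_const_right _ (-‖w‖) tendsto_natCast_atTop_atTop)
  have := norm_sub_le (w + N) w
  rw [add_sub_cancel_left, Complex.norm_natCast] at this
  linarith

theorem hurwitzDeriv_succ {j m : ℕ} (hm : j + 2 ≤ m) {w : ℂ} (hw : w ∈ Complex.slitPlane) :
    hurwitzDeriv j (m + 1) w = hurwitzDeriv j m w := by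
  obtain ⟨k, rfl⟩ := Nat.exists_eq_add_of_le hm
  have hk1 : j + 2 + k - j = k + 2 := by omega
  have hk2 : j + 2 + k + 1 - j = k + 1 + 2 := by omega
  -- both sides have the same increments, so their difference is constant along `w + N`
  have hper : ∀ N : ℕ, hurwitzDeriv j (j + 2 + k + 1) (w + N) - hurwitzDeriv j (j + 2 + k) (w + N)
      = hurwitzDeriv j (j + 2 + k + 1) w - hurwitzDeriv j (j + 2 + k) w := by
    intro N
    induction N with
    | zero => simp
    | succ N ih =>
      have hN : w + (N : ℂ) ∈ Complex.slitPlane := by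
        simpa using add_ofReal_mem_slitPlane hw (Nat.cast_nonneg N)
      rw [← ih]
      push_cast
      rw [← add_assoc, hurwitzDeriv_add_one (by omega) hN, hurwitzDeriv_add_one (by omega) hN]
      ring
  have hlim : Tendsto (fun N : ℕ => hurwitzDeriv j (j + 2 + k + 1) (w + N)
      - hurwitzDeriv j (j + 2 + k) (w + N)) atTop (nhds 0) := by
    simp only [hurwitzDeriv, hk1, hk2, Finset.sum_range_succ _ (j + 2 + k + 1),
      powLogSeq_of_lt (show j < j + 2 + k by omega)]
    have h1 := (tendsto_inv_add_natCast_pow w (k + 1)).const_mul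
      ((bernoulli (j + 2 + k + 1) : ℂ) / ((j + 2 + k + 1).factorial : ℂ)
        * (Polynomial.derivative (descPochhammer ℂ (j + 2 + k))).eval (j : ℂ))
    have h2 := (tendsto_bernoulliIntegral_add_natCast (j + 2 + k + 1) (k + 1) hw).const_mul
      ((-1) ^ (j + 2 + k + 1) / ((j + 2 + k + 1).factorial : ℂ)
        * (Polynomial.derivative (descPochhammer ℂ (j + 2 + k + 1))).eval (j : ℂ))
    have h3 := (tendsto_bernoulliIntegral_add_natCast (j + 2 + k) k hw).const_mul
      ((-1) ^ (j + 2 + k) / ((j + 2 + k).factorial : ℂ)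
        * (Polynomial.derivative (descPochhammer ℂ (j + 2 + k))).eval (j : ℂ))
    have h := (h1.add h2).sub h3
    simp only [mul_zero, add_zero, sub_zero] at h
    refine h.congr fun N => ?_
    ring
  have := tendsto_nhds_unique (tendsto_const_nhds.congr fun N => (hper N).symm) hlim
  exact sub_eq_zero.1 this

theorem hurwitzDeriv_eq {j m m' : ℕ} (hm : j + 2 ≤ m) (hmm : m ≤ m') {w : ℂ}
    (hw : w ∈ Complex.slitPlane) : hurwitzDeriv j m' w = hurwitzDeriv j m w := by
  induction m', hmm using Nat.le_induction with
  | base => rfl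
  | succ n hn ih => rw [hurwitzDeriv_succ (hm.trans hn) hw, ih]

/-! ### The derivative of the Riemann zeta function at nonpositive integers -/

/-- The integral over `(0, ∞)` of the periodic Bernoulli function of degree `m` against
`(1 + t) ^ (-s - m)`, written as a Mellin transform. -/
noncomputable def zetaRemainder (m : ℕ) (s : ℂ) : ℂ :=
  mellin ((Set.Ioi (1 : ℝ)).indicator fun t => (bernoulliFun m (Int.fract t) : ℂ)) (1 - s - m)

theorem zetaRemainder_aux (m : ℕ) (a : ℝ) :
    MeasureTheory.LocallyIntegrableOn
      ((Set.Ioi (1 : ℝ)).indicator fun t => (bernoulliFun m (Int.fract t) : ℂ)) (Set.Ioi 0) ∧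
    ((Set.Ioi (1 : ℝ)).indicator fun t => (bernoulliFun m (Int.fract t) : ℂ))
      =O[atTop] (fun t : ℝ => t ^ (-(0 : ℝ))) ∧
    ((Set.Ioi (1 : ℝ)).indicator fun t => (bernoulliFun m (Int.fract t) : ℂ))
      =O[nhdsWithin 0 (Set.Ioi 0)] (fun t : ℝ => t ^ (-a)) := by
  obtain ⟨C, hC0, hC⟩ := bernoulliFun_fract_bounded m
  have hb : ∀ t, ‖(Set.Ioi (1 : ℝ)).indicator
      (fun t => (bernoulliFun m (Int.fract t) : ℂ)) t‖ ≤ C := fun t =>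
    (norm_indicator_le_norm_self _ _).trans (hC t)
  refine ⟨?_, ?_, ?_⟩
  · refine MeasureTheory.LocallyIntegrable.locallyIntegrableOn ?_ _
    refine (MeasureTheory.locallyIntegrable_const C).mono
      ((measurable_bernoulliFun_fract m).indicator measurableSet_Ioi).aestronglyMeasurable
      (Eventually.of_forall fun t => ?_)
    rw [Real.norm_of_nonneg hC0.le]
    exact hb t
  · refine IsBigO.of_bound C (Eventually.of_forall fun t => ?_)
    simpa using hb t
  · have : ∀ᶠ t : ℝ in nhdsWithin 0 (Set.Ioi 0), t < 1 :=
      nhdsWithin_le_nhds (Iio_mem_nhds one_pos)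
    refine IsBigO.of_bound 1 (this.mono fun t ht => ?_)
    rw [Set.indicator_of_notMem (by simpa using ht.le), norm_zero]
    positivity

theorem differentiableAt_zetaRemainder (m : ℕ) {s : ℂ} (hs : 1 - m < s.re) :
    DifferentiableAt ℂ (zetaRemainder m) s := by
  obtain ⟨h1, h2, h3⟩ := zetaRemainder_aux m ((1 - s - m).re - 1)
  have h := mellin_differentiableAt_of_isBigO_rpow (s := 1 - s - m) h1 h2 (by simp; linarith) h3
    (by linarith)
  have h' : DifferentiableAt ℂ (fun s : ℂ => 1 - s - m) s := by fun_prop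
  exact DifferentiableAt.comp s (g := mellin _) h h'

theorem zetaRemainder_integrand (m : ℕ) (s : ℂ) :
    (Set.Ioi (0 : ℝ)).indicator (fun t => (t : ℂ) ^ (1 - s - m - 1) • (Set.Ioi (1 : ℝ)).indicator
        (fun t => (bernoulliFun m (Int.fract t) : ℂ)) t)
      = (Set.Ioi (1 : ℝ)).indicator fun t : ℝ =>
        (bernoulliFun m (Int.fract t) : ℂ) * (t : ℂ) ^ (-s - m) := by
  ext t
  by_cases h1 : 1 < t
  · rw [Set.indicator_of_mem (show t ∈ Set.Ioi (0 : ℝ) from by simp; linarith),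
      Set.indicator_of_mem (Set.mem_Ioi.2 h1), Set.indicator_of_mem (Set.mem_Ioi.2 h1),
      smul_eq_mul, mul_comm]
    congr 2
    ring
  · rw [Set.indicator_of_notMem (s := Set.Ioi 1) (by simpa using h1)]
    simp [Set.indicator_of_notMem (s := Set.Ioi 1) (show t ∉ Set.Ioi (1 : ℝ) by simpa using h1)]

theorem zetaRemainder_eq (m : ℕ) (s : ℂ) :
    zetaRemainder m s = ∫ t in Set.Ioi (0 : ℝ),
      (bernoulliFun m (Int.fract t) : ℂ) * (1 + (t : ℂ)) ^ (-s - m) := by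
  have h := integral_Ioi_comp_add_left (fun t : ℝ =>
    (bernoulliFun m (Int.fract t) : ℂ) * (t : ℂ) ^ (-s - m)) 0 1
  simp only [Int.fract_one_add, Complex.ofReal_add, Complex.ofReal_one, add_zero] at h
  rw [h, zetaRemainder, mellin, ← MeasureTheory.integral_indicator measurableSet_Ioi,
    zetaRemainder_integrand, MeasureTheory.integral_indicator measurableSet_Ioi]

theorem integrableOn_zetaRemainder (m : ℕ) {s : ℂ} (hs : 1 - m < s.re) :
    MeasureTheory.IntegrableOn (fun t : ℝ =>
      (bernoulliFun m (Int.fract t) : ℂ) * (1 + (t : ℂ)) ^ (-s - m)) (Set.Ioi 0) := by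
  obtain ⟨h1, h2, h3⟩ := zetaRemainder_aux m ((1 - s - m).re - 1)
  have h := mellinConvergent_of_isBigO_rpow (s := 1 - s - m) h1 h2 (by simp; linarith) h3
    (by linarith)
  rw [MellinConvergent, ← MeasureTheory.integrable_indicator_iff measurableSet_Ioi,
    zetaRemainder_integrand, MeasureTheory.integrable_indicator_iff measurableSet_Ioi] at h
  have h' := (integrableOn_Ioi_comp_add_left (fun t : ℝ =>
    (bernoulliFun m (Int.fract t) : ℂ) * (t : ℂ) ^ (-s - m)) 0 1).2 (by simpa using h)
  simpa only [Int.fract_one_add, Complex.ofReal_add, Complex.ofReal_one] using h'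

/-- The Euler–Maclaurin formula for `∑ (1 + k) ^ (-s)` over `k < N`, in the limit `N → ∞`. -/
theorem riemannZeta_euler_maclaurin_of_one_lt_re (m : ℕ) {s : ℂ} (hs : 1 < s.re) :
    riemannZeta s = 1 / (s - 1)
      - ∑ r ∈ Finset.range (m + 1), (bernoulli (r + 1) : ℂ) / ((r + 1).factorial : ℂ)
          * (descPochhammer ℂ r).eval (-s)
      - (-1) ^ (m + 1) / ((m + 1).factorial : ℂ)
          * ((descPochhammer ℂ (m + 1)).eval (-s) * zetaRemainder (m + 1) s) := by
  have hs1 : 1 - s ≠ 0 := by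
    intro h
    have := congrArg Complex.re h
    simp at this
    linarith
  -- the primitive of `(1 + t) ^ (-s)` followed by the derivatives of `(1 + t) ^ (-s)`
  let a : ℕ → ℝ → ℂ := fun i => match i with
    | 0 => fun t => (1 + (t : ℂ)) ^ (1 - s) / (1 - s)
    | i + 1 => fun t => (descPochhammer ℂ i).eval (-s) * (1 + (t : ℂ)) ^ (-s - i)
  have hslit : ∀ t : ℝ, 0 ≤ t → (1 + (t : ℂ)) ∈ Complex.slitPlane := fun t ht =>
    add_ofReal_mem_slitPlane Complex.one_mem_slitPlane ht
  have hpow : ∀ (p : ℂ) (t : ℝ), 0 ≤ t → HasDerivAt (fun t : ℝ => (1 + (t : ℂ)) ^ p)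
      (p * (1 + (t : ℂ)) ^ (p - 1)) t := by
    intro p t ht
    have h := (((hasDerivAt_id (t : ℂ)).const_add 1).cpow_const (c := p) (hslit t ht)).comp_ofReal
    simpa using h
  have ha : ∀ i, ∀ t : ℝ, 0 ≤ t → HasDerivAt (a i) (a (i + 1) t) t := by
    intro i t ht
    cases i with
    | zero =>
      refine ((hpow (1 - s) t ht).div_const (1 - s)).congr_deriv ?_
      simp only [a, descPochhammer_zero, Polynomial.eval_one, Nat.cast_zero]
      rw [mul_div_cancel_left₀ _ hs1, one_mul]
      congr 1; ring
    | succ i =>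
      refine ((hpow (-s - i) t ht).const_mul _).congr_deriv ?_
      simp only [a, descPochhammer_succ_eval]
      rw [mul_assoc]
      congr 3
      push_cast; ring
  have hlim0 : ∀ p : ℂ, p.re < 0 →
      Tendsto (fun N : ℕ => (1 + ((N : ℝ) : ℂ)) ^ p) atTop (nhds 0) := by
    intro p hp
    rw [tendsto_zero_iff_norm_tendsto_zero]
    have h1 : Tendsto (fun N : ℕ => (1 + (N : ℝ)) ^ (-(-p.re))) atTop (nhds 0) :=
      (tendsto_rpow_neg_atTop (by linarith)).comp
        (tendsto_atTop_add_const_left _ _ tendsto_natCast_atTop_atTop)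
    refine h1.congr fun N => ?_
    have h2 : (1 + ((N : ℝ) : ℂ)) = ((1 + (N : ℝ) : ℝ) : ℂ) := by push_cast; ring
    rw [h2, Complex.norm_cpow_eq_rpow_re_of_pos (by positivity), neg_neg]
  have hlima : ∀ i, Tendsto (fun N : ℕ => a i N) atTop (nhds 0) := by
    intro i
    cases i with
    | zero => simpa [a] using (hlim0 (1 - s) (by simp; linarith)).div_const (1 - s)
    | succ i =>
      have hi : (0 : ℝ) ≤ i := Nat.cast_nonneg i
      simpa [a] using (hlim0 (-s - i) (by simp; linarith)).const_mul
        ((descPochhammer ℂ i).eval (-s))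
  have hm : (0 : ℝ) ≤ m := Nat.cast_nonneg m
  have hint := MeasureTheory.intervalIntegral_tendsto_integral_Ioi 0
    (integrableOn_zetaRemainder (m + 1) (s := s)
    (by push_cast; linarith)) tendsto_natCast_atTop_atTop
  rw [← zetaRemainder_eq] at hint
  have hsum : Tendsto (fun N : ℕ => ∑ k ∈ Finset.range N, a 1 k) atTop (nhds (riemannZeta s)) := by
    have h1 := zeta_eq_tsum_one_div_nat_add_one_cpow hs
    have h2 : Summable fun n : ℕ => 1 / ((n : ℂ) + 1) ^ s := by
      have := (summable_nat_add_iff 1).2 (Complex.summable_one_div_nat_cpow.2 hs)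
      simpa using this
    rw [h1]
    refine h2.hasSum.tendsto_sum_nat.congr fun N => Finset.sum_congr rfl fun k _ => ?_
    simp [a, Complex.cpow_neg, add_comm]
  have hEM := fun N => euler_maclaurin_nat a ha m N
  have hL : Tendsto (fun N : ℕ => ∑ r ∈ Finset.range (m + 2), (bernoulli r : ℂ) / (r.factorial : ℂ)
      * (a r N - a r 0)) atTop (nhds (∑ r ∈ Finset.range (m + 2),
        (bernoulli r : ℂ) / (r.factorial : ℂ) * (0 - a r 0))) :=
    tendsto_finsetSum _ fun r _ => ((hlima r).sub_const _).const_mul _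
  have hR := hsum.add ((hint.const_mul ((descPochhammer ℂ (m + 1)).eval (-s))).const_mul
    ((-1) ^ (m + 1) / ((m + 1).factorial : ℂ)))
  have hval := tendsto_nhds_unique hL (hR.congr fun N => by
    rw [hEM N, ← intervalIntegral.integral_const_mul]
    congr 2
    refine intervalIntegral.integral_congr fun t _ => ?_
    simp only [a]
    ring)
  rw [Finset.sum_range_succ'] at hval
  simp only [a, Complex.ofReal_zero, add_zero, Complex.one_cpow, mul_one, zero_sub, mul_neg,
    Finset.sum_neg_distrib, bernoulli_zero, Rat.cast_one, Nat.factorial_zero, Nat.cast_one,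
    div_one, one_mul] at hval
  have h3 : 1 / (s - 1) = -(1 / (1 - s)) := by rw [← neg_sub 1 s, div_neg]
  rw [h3]
  linear_combination -hval

/-- `riemannZeta₀` is the entire function `ζ(s) - 1 / (s - 1)`; both sides are analytic in the
half-plane `Re s > -m`, so the identity propagates from `Re s > 1`. -/
theorem riemannZeta₀_euler_maclaurin (m : ℕ) {s : ℂ} (hs : -(m : ℝ) < s.re) :
    riemannZeta₀ s =
      - ∑ r ∈ Finset.range (m + 1), (bernoulli (r + 1) : ℂ) / ((r + 1).factorial : ℂ)
          * (descPochhammer ℂ r).eval (-s)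
      - (-1) ^ (m + 1) / ((m + 1).factorial : ℂ)
          * ((descPochhammer ℂ (m + 1)).eval (-s) * zetaRemainder (m + 1) s) := by
  have hopen : IsOpen {s : ℂ | -(m : ℝ) < s.re} := isOpen_lt continuous_const Complex.continuous_re
  have hpoly : ∀ r, Differentiable ℂ fun s : ℂ => (descPochhammer ℂ r).eval (-s) := fun r =>
    (descPochhammer ℂ r).differentiable.comp differentiable_neg
  refine AnalyticOnNhd.eqOn_of_preconnected_of_eventuallyEq (U := {s : ℂ | -(m : ℝ) < s.re})
    (f := riemannZeta₀) (z₀ := 2)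
    (g := fun s => - ∑ r ∈ Finset.range (m + 1), (bernoulli (r + 1) : ℂ) / ((r + 1).factorial : ℂ)
          * (descPochhammer ℂ r).eval (-s)
      - (-1) ^ (m + 1) / ((m + 1).factorial : ℂ)
          * ((descPochhammer ℂ (m + 1)).eval (-s) * zetaRemainder (m + 1) s))
    (differentiable_riemannZeta₀.differentiableOn.analyticOnNhd hopen)
    (DifferentiableOn.analyticOnNhd (fun s hs => ?_) hopen)
    (convex_halfSpace_re_gt _).isPreconnected
    ?_ ?_ hs
  · have h1 : DifferentiableAt ℂ (zetaRemainder (m + 1)) s :=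
      differentiableAt_zetaRemainder _ (by
        have : -(m : ℝ) < s.re := hs
        push_cast; linarith)
    have h2 := fun r => (hpoly r) s
    refine DifferentiableAt.differentiableWithinAt ?_
    fun_prop
  · have : (0 : ℝ) ≤ m := Nat.cast_nonneg m
    show -(m : ℝ) < (2 : ℂ).re
    norm_num
    linarith
  · have h : ∀ᶠ s : ℂ in nhds 2, 1 < s.re :=
      (isOpen_lt continuous_const Complex.continuous_re).mem_nhds (by norm_num)
    filter_upwards [h] with s hs
    have hs1 : s ≠ 1 := by rintro rfl; simp at hs
    have h1 := riemannZeta_euler_maclaurin_of_one_lt_re m hs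
    rw [riemannZeta_eq_inv_sub_add hs1, one_div] at h1
    linear_combination h1

theorem hurwitzDeriv_one (j m : ℕ) :
    hurwitzDeriv j m 1 = ∑ r ∈ Finset.range m, (bernoulli (r + 1) : ℂ) / ((r + 1).factorial : ℂ)
        * (Polynomial.derivative (descPochhammer ℂ r)).eval (j : ℂ) - 1 / ((j : ℂ) + 1) ^ 2
      + (-1) ^ m / (m.factorial : ℂ) * ((Polynomial.derivative (descPochhammer ℂ m)).eval (j : ℂ)
        * bernoulliIntegral m (m - j) 1) := by
  rw [hurwitzDeriv, Finset.sum_range_succ']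
  simp [powLogSeq]
  ring

theorem deriv_riemannZeta_neg_natCast {j m : ℕ} (hm : j + 2 ≤ m) :
    deriv riemannZeta (-(j : ℂ)) = hurwitzDeriv j m 1 := by
  obtain ⟨k, rfl⟩ := Nat.exists_eq_add_of_le hm
  have hre : -((j + 1 + k : ℕ) : ℝ) < (-(j : ℂ)).re := by
    have : (0 : ℝ) ≤ k := Nat.cast_nonneg k
    push_cast
    simp
    linarith
  have hj1 : -(j : ℂ) ≠ 1 := by
    intro h
    have := congrArg Complex.re h
    simp at this
    linarith [(Nat.cast_nonneg j : (0 : ℝ) ≤ j)]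
  have hpoly : ∀ r, HasDerivAt (fun s : ℂ => (descPochhammer ℂ r).eval (-s))
      (-(Polynomial.derivative (descPochhammer ℂ r)).eval (j : ℂ)) (-(j : ℂ)) := fun r => by
    have h := ((descPochhammer ℂ r).hasDerivAt (-(-(j : ℂ)))).comp (-(j : ℂ)) (hasDerivAt_neg _)
    simpa [Function.comp_def] using h
  have hK : DifferentiableAt ℂ (zetaRemainder (j + 1 + k + 1)) (-(j : ℂ)) :=
    differentiableAt_zetaRemainder _ (by push_cast at hre ⊢; linarith)
  -- the factor in front of the remainder vanishes at `-j`, so only its derivative contributes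
  have hmul := (hpoly (j + 1 + k + 1)).mul hK.hasDerivAt
  rw [neg_neg, descPochhammer_eval_natCast_eq_zero (show j < j + 1 + k + 1 by omega), zero_mul,
    add_zero] at hmul
  have hsum := HasDerivAt.fun_sum fun r (_ : r ∈ Finset.range (j + 1 + k + 1)) =>
    (hpoly r).const_mul ((bernoulli (r + 1) : ℂ) / ((r + 1).factorial : ℂ))
  have htot := hsum.neg.sub (hmul.const_mul
    ((-1) ^ (j + 1 + k + 1) / ((j + 1 + k + 1).factorial : ℂ)))
  have hev : riemannZeta₀ =ᶠ[nhds (-(j : ℂ))] _ :=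
    (isOpen_lt (continuous_const (y := -((j + 1 + k : ℕ) : ℝ))) Complex.continuous_re).mem_nhds hre
      |> fun h => Filter.mem_of_superset h fun s hs => riemannZeta₀_euler_maclaurin (j + 1 + k) hs
  have hz := (htot.congr_of_eventuallyEq hev).deriv
  have hJ : zetaRemainder (j + 1 + k + 1) (-(j : ℂ))
      = bernoulliIntegral (j + 2 + k) (k + 2) 1 := by
    rw [zetaRemainder_eq, bernoulliIntegral]
    refine MeasureTheory.setIntegral_congr_fun measurableSet_Ioi fun t _ => ?_
    have : -(-(j : ℂ)) - (j + 1 + k + 1 : ℕ) = -((k + 2 : ℕ) : ℂ) := by push_cast; ring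
    simp only [this, Complex.cpow_neg, Complex.cpow_natCast]
    rw [show j + 1 + k + 1 = j + 2 + k by ring]
  have hsub : j + 2 + k - j = k + 2 := by omega
  have h4 : (-(j : ℂ) - 1)⁻¹ = -((j : ℂ) + 1)⁻¹ := by rw [← inv_neg]; congr 1; ring
  rw [deriv_riemannZeta_eq_neg_inv_sub_sq_add hj1, hz, hJ, hurwitzDeriv_one, hsub, h4,
    show j + 1 + k + 1 = j + 2 + k by ring]
  simp only [mul_neg, Finset.sum_neg_distrib, one_div, ← inv_pow]
  ring

/-! ### Binomial polynomials -/

theorem binomPoly_zero : binomPoly 0 = 1 := by simp [binomPoly]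

theorem natDegree_binomPoly_le (k : ℕ) : (binomPoly k).natDegree ≤ k := by
  refine (Polynomial.natDegree_C_mul_le _ _).trans ?_
  rw [descPochhammer_natDegree]

theorem binomPoly_succ_eval_zero (k : ℕ) : (binomPoly (k + 1)).eval 0 = 0 := by
  simp [binomPoly]

/-- Pascal's rule. -/
theorem binomPoly_succ_eval_add_one (k : ℕ) (x : ℂ) :
    (binomPoly (k + 1)).eval (x + 1) = (binomPoly (k + 1)).eval x + (binomPoly k).eval x := by
  have h1 : (descPochhammer ℂ (k + 1)).eval (x + 1) = (x + 1) * (descPochhammer ℂ k).eval x := by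
    rw [descPochhammer_succ_left]
    simp
  have h2 := descPochhammer_succ_eval k x
  have h3 : ((k + 1).factorial : ℂ) = ((k : ℂ) + 1) * (k.factorial : ℂ) := by
    rw [Nat.factorial_succ]; push_cast; ring
  have h4 : (k.factorial : ℂ) ≠ 0 := by exact_mod_cast Nat.factorial_ne_zero _
  have h5 : (k : ℂ) + 1 ≠ 0 := by exact_mod_cast Nat.succ_ne_zero k
  simp only [binomPoly, Polynomial.eval_mul, Polynomial.eval_C, h1, h2, h3]
  field_simp
  ring

theorem natDegree_binomPoly_comp_lt {n : ℕ} (hn : 1 ≤ n) (z : ℂ) :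
    ((binomPoly (n - 1)).comp (Polynomial.C z - Polynomial.X)).natDegree < n := by
  have h1 : (Polynomial.C z - Polynomial.X : Polynomial ℂ).natDegree ≤ 1 := by
    refine (Polynomial.natDegree_sub_le _ _).trans ?_
    simp
  have h2 := natDegree_binomPoly_le (n - 1)
  have h3 := Polynomial.natDegree_comp_le (p := binomPoly (n - 1))
    (q := (Polynomial.C z - Polynomial.X : Polynomial ℂ))
  have h4 := Nat.mul_le_mul h2 h1
  omega

theorem binomCoeff_eq_zero {n j : ℕ} (hn : 1 ≤ n) (hj : n ≤ j) (z : ℂ) : binomCoeff n j z = 0 :=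
  Polynomial.coeff_eq_zero_of_natDegree_lt ((natDegree_binomPoly_comp_lt hn z).trans_le hj)

theorem sum_binomCoeff_mul_pow {n : ℕ} (hn : 1 ≤ n) (z u : ℂ) :
    ∑ j ∈ Finset.range n, binomCoeff n j z * u ^ j = (binomPoly (n - 1)).eval (z - u) := by
  have h := Polynomial.eval_eq_sum_range' (natDegree_binomPoly_comp_lt hn z) u
  rw [Polynomial.eval_comp] at h
  simpa [binomCoeff] using h.symm

theorem binomCoeff_succ_add_one {n : ℕ} (hn : 1 ≤ n) (j : ℕ) (z : ℂ) :
    binomCoeff (n + 1) j (z + 1) = binomCoeff (n + 1) j z + binomCoeff n j z := by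
  obtain ⟨k, rfl⟩ := Nat.exists_eq_add_of_le' hn
  simp only [binomCoeff, Nat.add_sub_cancel, ← Polynomial.coeff_add]
  congr 1
  refine Polynomial.funext fun u => ?_
  simp only [Polynomial.eval_add, Polynomial.eval_comp, Polynomial.eval_sub, Polynomial.eval_C,
    Polynomial.eval_X]
  rw [← binomPoly_succ_eval_add_one]
  congr 1; ring

theorem binomCoeff_eq (n j : ℕ) (z : ℂ) :
    binomCoeff n j z = (-1) ^ j / (j.factorial : ℂ)
      * (Polynomial.derivative^[j] (binomPoly (n - 1))).eval z := by
  have h1 : (binomPoly (n - 1)).comp (Polynomial.C z - Polynomial.X)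
      = (Polynomial.taylor z (binomPoly (n - 1))).comp (Polynomial.C (-1) * Polynomial.X) := by
    rw [Polynomial.taylor_apply, Polynomial.comp_assoc]
    congr 1
    simp
    ring
  have h2 : (j.factorial : ℂ) ≠ 0 := by exact_mod_cast Nat.factorial_ne_zero _
  have h3 := congrArg (fun f => Polynomial.eval z (f (binomPoly (n - 1))))
    (Polynomial.factorial_smul_hasseDeriv (R := ℂ) (k := j))
  rw [LinearMap.smul_apply, Polynomial.eval_smul, nsmul_eq_mul] at h3
  rw [binomCoeff, h1, Polynomial.comp_C_mul_X_coeff, Polynomial.taylor_coeff, ← h3]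
  field_simp

theorem differentiable_binomCoeff (n j : ℕ) : Differentiable ℂ (binomCoeff n j) := by
  have : binomCoeff n j = fun z => (-1) ^ j / (j.factorial : ℂ)
      * (Polynomial.derivative^[j] (binomPoly (n - 1))).eval z := funext (binomCoeff_eq n j)
  rw [this]
  exact (Polynomial.differentiable _).const_mul _

/-! ### The logarithm of the multiple gamma function -/

/-- The branch of `log Gₙ(z + 1)`: formally `-∑ₖ C(-k, n - 1) log (z + k)` over `k ≥ 1`, where the
binomial coefficient is expanded in powers of `z + k` and the sums `∑ₖ (z + k) ^ j log (z + k)` are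
regularized by derivatives of the Hurwitz zeta function, normalized to vanish at `z = 0`. -/
noncomputable def logMultipleGamma : ℕ → ℂ → ℂ
  | 0 => fun z => Complex.log (z + 1)
  | n + 1 => fun z => ∑ j ∈ Finset.range (n + 1), binomCoeff (n + 1) j z
      * (hurwitzDeriv j (j + 2) (z + 1) - deriv riemannZeta (-(j : ℂ)))

theorem logMultipleGamma_zero_right (n : ℕ) : logMultipleGamma n 0 = 0 := by
  cases n with
  | zero => simp [logMultipleGamma]
  | succ n =>
    refine Finset.sum_eq_zero fun j _ => ?_
    rw [zero_add, deriv_riemannZeta_neg_natCast le_rfl, sub_self, mul_zero]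

theorem differentiableOn_logMultipleGamma (n : ℕ) :
    DifferentiableOn ℂ (logMultipleGamma n) {z | z + 1 ∈ Complex.slitPlane} := by
  have hadd : DifferentiableOn ℂ (fun z : ℂ => z + 1) {z | z + 1 ∈ Complex.slitPlane} := by fun_prop
  cases n with
  | zero => exact hadd.clog fun z hz => hz
  | succ n =>
    refine DifferentiableOn.fun_sum fun j _ => ?_
    refine (differentiable_binomCoeff _ _).differentiableOn.mul (DifferentiableOn.sub_const ?_ _)
    exact (differentiableOn_hurwitzDeriv le_rfl).comp hadd fun z hz => hz

/-- The logarithm of the functional equation `G (n + 1) (z + 1) = G n z * G (n + 1) z`, at `z + 1`.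
The increments of `hurwitzDeriv` contribute `C(0, n) * log (z + 1)` in total, which is zero unless
`n = 0`; the remaining increment is Pascal's rule for the coefficients. -/
theorem logMultipleGamma_add_one (n : ℕ) {z : ℂ} (hz : z + 1 ∈ Complex.slitPlane) :
    logMultipleGamma (n + 1) (z + 1) = logMultipleGamma (n + 1) z + logMultipleGamma n z := by
  have hH : ∀ j : ℕ, hurwitzDeriv j (j + 2) (z + 1 + 1)
      = hurwitzDeriv j (j + 2) (z + 1) + (z + 1) ^ j * Complex.log (z + 1) := fun j =>
    hurwitzDeriv_add_one le_rfl hz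
  cases n with
  | zero =>
    simp [logMultipleGamma, hH, binomCoeff, binomPoly_zero]
    ring
  | succ k =>
    have h0 : ∑ j ∈ Finset.range (k + 1 + 1), binomCoeff (k + 1 + 1) j (z + 1) * (z + 1) ^ j
        = 0 := by
      rw [sum_binomCoeff_mul_pow (by omega), sub_self, Nat.add_sub_cancel, binomPoly_succ_eval_zero]
    have h1 : logMultipleGamma (k + 1) z = ∑ j ∈ Finset.range (k + 1 + 1), binomCoeff (k + 1) j z
        * (hurwitzDeriv j (j + 2) (z + 1) - deriv riemannZeta (-(j : ℂ))) := by
      rw [Finset.sum_range_succ, binomCoeff_eq_zero (by omega) le_rfl, zero_mul, add_zero]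
      rfl
    rw [h1]
    simp only [logMultipleGamma, hH]
    calc _ = ∑ j ∈ Finset.range (k + 1 + 1), (binomCoeff (k + 1 + 1) j (z + 1)
          * (hurwitzDeriv j (j + 2) (z + 1) - deriv riemannZeta (-(j : ℂ))))
          + (∑ j ∈ Finset.range (k + 1 + 1), binomCoeff (k + 1 + 1) j (z + 1) * (z + 1) ^ j)
            * Complex.log (z + 1) := by
          rw [Finset.sum_mul, ← Finset.sum_add_distrib]
          exact Finset.sum_congr rfl fun j _ => by ring
      _ = _ := by
          rw [h0, zero_mul, add_zero, ← Finset.sum_add_distrib]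
          refine Finset.sum_congr rfl fun j _ => ?_
          rw [binomCoeff_succ_add_one (by omega)]
          ring

/-! ### Reality on the positive axis -/

theorem conj_eval_of_map_eq {P : Polynomial ℂ} (hP : P.map (starRingEnd ℂ) = P) (x : ℝ) :
    starRingEnd ℂ (P.eval (x : ℂ)) = P.eval (x : ℂ) := by
  conv_rhs => rw [← hP, ← Complex.conj_ofReal x]
  rw [Polynomial.eval_map, Polynomial.eval₂_at_apply]

theorem conj_powLogSeq (j i : ℕ) {x : ℝ} (hx : 0 < x) :
    starRingEnd ℂ (powLogSeq j i x) = powLogSeq j i x := by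
  have hlog : starRingEnd ℂ (Complex.log x) = Complex.log x := by
    rw [← Complex.ofReal_log hx.le, Complex.conj_ofReal]
  have hdesc := descPochhammer_map (starRingEnd ℂ)
  cases i with
  | zero => simp [powLogSeq, hlog]
  | succ i =>
    have h1 := conj_eval_of_map_eq (hdesc i) j
    have h2 := conj_eval_of_map_eq (P := Polynomial.derivative (descPochhammer ℂ i))
      (by rw [← Polynomial.derivative_map, hdesc]) j
    simp only [Complex.ofReal_natCast] at h1 h2
    simp [powLogSeq, hlog, h1, h2]

theorem conj_hurwitzDeriv (j m : ℕ) {x : ℝ} (hx : 0 < x) :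
    starRingEnd ℂ (hurwitzDeriv j m x) = hurwitzDeriv j m x := by
  have h2 := conj_eval_of_map_eq (P := Polynomial.derivative (descPochhammer ℂ m))
      (by rw [← Polynomial.derivative_map, descPochhammer_map]) j
  rw [Complex.ofReal_natCast] at h2
  have h3 : starRingEnd ℂ (bernoulliIntegral m (m - j) x) = bernoulliIntegral m (m - j) x := by
    rw [bernoulliIntegral, ← integral_conj]
    simp
  simp [hurwitzDeriv, h2, h3, conj_powLogSeq _ _ hx]

theorem logMultipleGamma_ofReal_im (n : ℕ) {x : ℝ} (hx : -1 < x) :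
    (logMultipleGamma n x).im = 0 := by
  have hx' : (x : ℂ) + 1 = ((x + 1 : ℝ) : ℂ) := by push_cast; ring
  rw [← Complex.conj_eq_iff_im]
  cases n with
  | zero =>
    simp only [logMultipleGamma]
    rw [hx', ← Complex.ofReal_log (by linarith), Complex.conj_ofReal]
  | succ n =>
    simp only [logMultipleGamma, hx', map_sum, map_mul, map_sub]
    refine Finset.sum_congr rfl fun j _ => ?_
    have h1 : starRingEnd ℂ (deriv riemannZeta (-(j : ℂ))) = deriv riemannZeta (-(j : ℂ)) := by
      have := conj_hurwitzDeriv j (j + 2) one_pos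
      rw [Complex.ofReal_one] at this
      rw [deriv_riemannZeta_neg_natCast le_rfl, this]
    have h2 : starRingEnd ℂ (binomCoeff (n + 1) j x) = binomCoeff (n + 1) j x := by
      have hmap : (binomPoly (n + 1 - 1)).map (starRingEnd ℂ) = binomPoly (n + 1 - 1) := by
        simp [binomPoly, descPochhammer_map]
      rw [binomCoeff, ← Polynomial.coeff_map, Polynomial.map_comp, hmap]
      simp
    rw [h1, h2, conj_hurwitzDeriv _ _ (by linarith)]

/-! ### Growth in sectors -/

theorem neg_cos_mul_norm_le_re {δ : ℝ} (hδ : 0 < δ) {z : ℂ}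
    (hz : z ∈ stirlingSector δ) : -Real.cos δ * ‖z‖ ≤ z.re := by
  have hz : |Complex.arg z| < Real.pi - δ := hz
  have h1 : Real.cos (Real.pi - δ) ≤ Real.cos |Complex.arg z| :=
    Real.cos_le_cos_of_nonneg_of_le_pi (abs_nonneg _) (by linarith) hz.le
  rw [Real.cos_pi_sub, Real.cos_abs] at h1
  rw [← Complex.norm_mul_cos_arg z, mul_comm ‖z‖]
  exact mul_le_mul_of_nonneg_right h1 (norm_nonneg _)

theorem add_one_mem_slitPlane_of_mem_sector {δ : ℝ} (hδ : 0 < δ) {z : ℂ}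
    (hz : z ∈ stirlingSector δ) : z + 1 ∈ Complex.slitPlane := by
  have hz : |Complex.arg z| < Real.pi - δ := hz
  by_cases h0 : z = 0
  · simp [h0]
  · have h1 : z ∈ Complex.slitPlane := by
      rw [Complex.mem_slitPlane_iff_arg]
      refine ⟨fun h => ?_, h0⟩
      rw [h, abs_of_pos Real.pi_pos] at hz
      linarith
    simpa using add_ofReal_mem_slitPlane h1 zero_le_one

theorem exists_mul_le_norm_of_mem_sector {δ : ℝ} (hδ : 0 < δ) (hδ' : δ < Real.pi) :
    ∃ c : ℝ, 0 < c ∧ ∀ z ∈ stirlingSector δ, ∀ t : ℝ, 0 ≤ t →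
      c * (‖z‖ + 1 + t) ≤ ‖z + 1 + t‖ := by
  have h1 : Real.cos δ < 1 := by
    simpa using Real.cos_lt_cos_of_nonneg_of_le_pi le_rfl hδ'.le hδ
  refine ⟨√((1 - Real.cos δ) / 2), Real.sqrt_pos.2 (by linarith), fun z hz t ht => ?_⟩
  have := sqrt_mul_le_norm_add_ofReal (Real.neg_one_le_cos δ) (neg_cos_mul_norm_le_re hδ hz)
    (t := 1 + t) (by linarith)
  push_cast at this
  rwa [← add_assoc, ← add_assoc] at this

theorem sectorAtInfty_le (δ : ℝ) : sectorAtInfty δ ≤ Bornology.cobounded ℂ := inf_le_left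

theorem eventually_one_le_norm : ∀ᶠ z : ℂ in Bornology.cobounded ℂ, 1 ≤ ‖z‖ :=
  tendsto_norm_cobounded_atTop.eventually_ge_atTop 1

theorem isLittleO_const_norm {E : Type*} [NormedAddCommGroup E] (c : E) :
    (fun _ : ℂ => c) =o[Bornology.cobounded ℂ] fun z : ℂ => ‖z‖ := by
  refine isLittleO_const_left.2 (Or.inr ?_)
  simpa [Function.comp_def] using tendsto_norm_cobounded_atTop (E := ℂ)

theorem isBigO_norm_zpow_of_le {a b : ℤ} (h : a ≤ b) :
    (fun z : ℂ => ‖z‖ ^ a) =O[Bornology.cobounded ℂ] fun z : ℂ => ‖z‖ ^ b := by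
  refine IsBigO.of_bound 1 (eventually_one_le_norm.mono fun z hz => ?_)
  rw [one_mul, Real.norm_of_nonneg (by positivity), Real.norm_of_nonneg (by positivity)]
  exact zpow_le_zpow_right₀ hz h

theorem norm_zpow_mul_norm_zpow (a b : ℤ) : (fun z : ℂ => ‖z‖ ^ a * ‖z‖ ^ b)
    =ᶠ[Bornology.cobounded ℂ] fun z : ℂ => ‖z‖ ^ (a + b) :=
  eventually_one_le_norm.mono fun z hz => (zpow_add₀ (by positivity) a b).symm

theorem isBigO_add_one_zpow (k : ℤ) :
    (fun z : ℂ => (z + 1) ^ k) =O[Bornology.cobounded ℂ] fun z : ℂ => ‖z‖ ^ k := by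
  have h1 : (fun _ : ℂ => (1 : ℂ)) =o[Bornology.cobounded ℂ] fun z : ℂ => z :=
    isLittleO_const_left.2 (Or.inr tendsto_norm_cobounded_atTop)
  have h2 : (fun z : ℂ => z + 1) =Θ[Bornology.cobounded ℂ] fun z : ℂ => ‖z‖ :=
    ((isTheta_refl (fun z : ℂ => z) _).add_isLittleO h1).norm_right
  exact (h2.zpow k).1

theorem isLittleO_log_add_one :
    (fun z : ℂ => Complex.log (z + 1)) =o[Bornology.cobounded ℂ] fun z : ℂ => ‖z‖ := by
  have hb : (fun z : ℂ => Complex.log (z + 1)) =O[Bornology.cobounded ℂ]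
      fun z : ℂ => |Real.log ‖z + 1‖| + Real.pi := by
    refine IsBigO.of_bound 1 (Eventually.of_forall fun z => ?_)
    rw [one_mul, Real.norm_of_nonneg (by positivity)]
    refine (Complex.norm_le_abs_re_add_abs_im _).trans ?_
    rw [Complex.log_re, Complex.log_im]
    exact add_le_add le_rfl (Complex.abs_arg_le_pi _)
  have ht : Tendsto (fun z : ℂ => ‖z + 1‖) (Bornology.cobounded ℂ) atTop := by
    refine tendsto_atTop_mono (fun z : ℂ => ?_)
      (tendsto_atTop_add_const_right _ (-1) tendsto_norm_cobounded_atTop)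
    have := norm_sub_le (z + 1) 1
    rw [add_sub_cancel_right, norm_one] at this
    linarith
  have h1 : (fun z : ℂ => Real.log ‖z + 1‖) =o[Bornology.cobounded ℂ] fun z : ℂ => ‖z + 1‖ :=
    Real.isLittleO_log_id_atTop.comp_tendsto ht
  have h2 : (fun z : ℂ => ‖z + 1‖) =O[Bornology.cobounded ℂ] fun z : ℂ => ‖z‖ := by
    simpa using (isBigO_add_one_zpow 1).norm_left
  refine hb.trans_isLittleO (((h1.trans_isBigO h2).norm_left).add ?_)
  exact isLittleO_const_norm _

theorem isBigO_eval_of_natDegree_le {P : Polynomial ℂ} {d : ℕ} (hP : P.natDegree ≤ d) :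
    (fun z : ℂ => P.eval z) =O[Bornology.cobounded ℂ] fun z : ℂ => ‖z‖ ^ (d : ℤ) := by
  simp only [Polynomial.eval_eq_sum_range]
  refine IsBigO.fun_sum fun i hi => IsBigO.const_mul_left ?_ _
  refine IsBigO.trans ?_ (isBigO_norm_zpow_of_le (a := i) (b := d) ?_)
  · exact IsBigO.of_bound 1 (Eventually.of_forall fun z => by simp)
  · have := Finset.mem_range.1 hi
    omega

theorem isBigO_binomCoeff {n : ℕ} (hn : 1 ≤ n) (j : ℕ) :
    binomCoeff n j =O[Bornology.cobounded ℂ] fun z : ℂ => ‖z‖ ^ ((n : ℤ) - 1 - j) := by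
  rcases lt_or_ge j n with h | h
  · rw [show binomCoeff n j = _ from funext (binomCoeff_eq n j)]
    refine IsBigO.const_mul_left ?_ _
    have h1 : (Polynomial.derivative^[j] (binomPoly (n - 1))).natDegree ≤ n - 1 - j :=
      (Polynomial.natDegree_iterate_derivative _ _).trans
        (Nat.sub_le_sub_right (natDegree_binomPoly_le _) _)
    have h2 : ((n - 1 - j : ℕ) : ℤ) = (n : ℤ) - 1 - j := by omega
    rw [← h2]
    exact isBigO_eval_of_natDegree_le h1
  · rw [show binomCoeff n j = fun _ => 0 from funext (binomCoeff_eq_zero hn h)]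
    exact isBigO_zero _ _

theorem isLittleO_powLogSeq (j i : ℕ) :
    (fun z : ℂ => powLogSeq j i (z + 1)) =o[Bornology.cobounded ℂ]
      fun z : ℂ => ‖z‖ ^ ((j : ℤ) + 2 - i) := by
  have key : ∀ (k : ℤ) (a b : ℂ), (fun z : ℂ => (z + 1) ^ k * (a * Complex.log (z + 1) + b))
      =o[Bornology.cobounded ℂ] fun z : ℂ => ‖z‖ ^ (k + 1) := by
    intro k a b
    have h := (isBigO_add_one_zpow k).mul_isLittleO
      ((isLittleO_log_add_one.const_mul_left a).add (isLittleO_const_norm b))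
    refine h.congr' EventuallyEq.rfl ?_
    simpa using norm_zpow_mul_norm_zpow k 1
  cases i with
  | zero =>
    refine (key (j + 1 : ℕ) (1 / ((j : ℂ) + 1)) (-(1 / ((j : ℂ) + 1) ^ 2))).congr (fun z => ?_)
      fun z => ?_
    · simp only [powLogSeq, zpow_natCast]; ring
    · congr 1
  | succ i =>
    refine (key ((j : ℤ) - i) ((descPochhammer ℂ i).eval (j : ℂ))
      ((Polynomial.derivative (descPochhammer ℂ i)).eval (j : ℂ))).congr (fun z => rfl) fun z => ?_
    congr 1; push_cast; ring

theorem isBigO_bernoulliIntegral (m k : ℕ) {δ : ℝ} (hδ : 0 < δ) (hδ' : δ < Real.pi) :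
    (fun z : ℂ => bernoulliIntegral m (k + 2) (z + 1)) =O[sectorAtInfty δ]
      fun z : ℂ => ‖z‖ ^ (-(k : ℤ) - 1) := by
  obtain ⟨c, hc, hcz⟩ := exists_mul_le_norm_of_mem_sector hδ hδ'
  obtain ⟨K, hK, hb⟩ := exists_norm_bernoulliIntegral_le m k hc
  refine IsBigO.of_bound K (eventually_inf_principal.2
    (eventually_one_le_norm.mono fun z hz hzs => ?_))
  refine (hb (‖z‖ + 1) (z + 1) (by positivity) (hcz z hzs)).trans ?_
  refine mul_le_mul_of_nonneg_left ?_ hK.le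
  have h1 : -(k : ℤ) - 1 = -((k + 1 : ℕ) : ℤ) := by push_cast; ring
  rw [h1, zpow_neg, zpow_natCast, norm_inv, norm_pow, norm_norm]
  gcongr
  linarith

theorem isLittleO_hurwitzDeriv (j : ℕ) {δ : ℝ} (hδ : 0 < δ) (hδ' : δ < Real.pi) :
    (fun z : ℂ => hurwitzDeriv j (j + 2) (z + 1)) =o[sectorAtInfty δ]
      fun z : ℂ => ‖z‖ ^ ((j : ℤ) + 2) := by
  refine IsLittleO.add (IsLittleO.fun_sum fun r _ => IsLittleO.const_mul_left ?_ _)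
    (IsLittleO.const_mul_left (IsLittleO.const_mul_left ?_ _) _)
  · exact ((isLittleO_powLogSeq j r).trans_isBigO
      (isBigO_norm_zpow_of_le (by omega))).mono (sectorAtInfty_le δ)
  · rw [show j + 2 - j = 0 + 2 by omega]
    refine (isBigO_bernoulliIntegral (j + 2) 0 hδ hδ').trans_isLittleO ?_
    have h' := (isBigO_refl (fun z : ℂ => ‖z‖ ^ (-1 : ℤ)) (Bornology.cobounded ℂ)).mul_isLittleO
      (isLittleO_const_norm (1 : ℝ))
    refine (IsLittleO.trans_isBigO (h'.congr' ?_
      (by simpa only [zpow_one] using norm_zpow_mul_norm_zpow (-1) 1))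
      (isBigO_norm_zpow_of_le (by omega))).mono (sectorAtInfty_le δ)
    exact Eventually.of_forall fun z => by simp

theorem isLittleO_logMultipleGamma (n : ℕ) {δ : ℝ} (hδ : 0 < δ) (hδ' : δ < Real.pi) :
    logMultipleGamma n =o[sectorAtInfty δ] fun z : ℂ => ‖z‖ ^ (n + 1) := by
  cases n with
  | zero => simpa [logMultipleGamma] using isLittleO_log_add_one.mono (sectorAtInfty_le δ)
  | succ n =>
    refine IsLittleO.fun_sum fun j hj => ?_
    have hc : (fun _ : ℂ => deriv riemannZeta (-(j : ℂ))) =o[sectorAtInfty δ]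
        fun z : ℂ => ‖z‖ ^ ((j : ℤ) + 2) := by
      refine IsLittleO.mono (isLittleO_const_left.2 (Or.inr ?_)) (sectorAtInfty_le δ)
      simp only [Function.comp_def, norm_zpow, norm_norm]
      exact (tendsto_pow_atTop (α := ℝ) (n := j + 2) (by omega)).comp tendsto_norm_cobounded_atTop
    have h :=
      ((isBigO_binomCoeff (n := n + 1) (by omega) j).mono (sectorAtInfty_le δ)).mul_isLittleO
      ((isLittleO_hurwitzDeriv j hδ hδ').sub hc)
    refine h.congr' EventuallyEq.rfl ?_
    refine (EventuallyEq.trans (norm_zpow_mul_norm_zpow _ _) ?_).filter_mono (sectorAtInfty_le δ)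
    refine Eventually.of_forall fun z => ?_
    show ‖z‖ ^ _ = ‖z‖ ^ (n + 1 + 1)
    rw [← zpow_natCast]
    congr 1
    push_cast; ring

/-! ### Derivatives on the real axis -/

theorem iteratedDeriv_eq_of_hasDerivAt {𝕜 E : Type*} [NontriviallyNormedField 𝕜]
    [NormedAddCommGroup E] [NormedSpace 𝕜 E] {a : ℕ → 𝕜 → E} {s : Set 𝕜} (hs : IsOpen s)
    (ha : ∀ i, ∀ x ∈ s, HasDerivAt (a i) (a (i + 1) x) x) (k : ℕ) {x : 𝕜} (hx : x ∈ s) :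
    iteratedDeriv k (a 0) x = a k x := by
  induction k generalizing x with
  | zero => rw [iteratedDeriv_zero]
  | succ k ih =>
    rw [iteratedDeriv_succ]
    have h : iteratedDeriv k (a 0) =ᶠ[nhds x] a k := by
      filter_upwards [hs.mem_nhds hx] with y hy using ih hy
    rw [h.deriv_eq, (ha k x hx).deriv]

theorem isOpen_add_one_slitPlane : IsOpen {z : ℂ | z + 1 ∈ Complex.slitPlane} :=
  Complex.isOpen_slitPlane.preimage (continuous_id.add continuous_const)

theorem ofReal_add_one_mem_slitPlane {x : ℝ} (hx : -1 < x) : (x : ℂ) + 1 ∈ Complex.slitPlane := by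
  rw [Complex.mem_slitPlane_iff]
  left
  simp
  linarith

theorem contDiffAt_logMultipleGamma (n : ℕ) {m : WithTop ℕ∞} {z : ℂ}
    (hz : z + 1 ∈ Complex.slitPlane) : ContDiffAt ℂ m (logMultipleGamma n) z :=
  ((differentiableOn_logMultipleGamma n).analyticAt
    (isOpen_add_one_slitPlane.mem_nhds hz)).contDiffAt

theorem iteratedDeriv_logMultipleGamma_add_one (n N : ℕ) {z : ℂ}
    (hz : z + 1 ∈ Complex.slitPlane) :
    iteratedDeriv N (logMultipleGamma (n + 1)) (z + 1)
      = iteratedDeriv N (logMultipleGamma (n + 1)) z + iteratedDeriv N (logMultipleGamma n) z := by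
  have h1 := congrFun (iteratedDeriv_comp_add_const N (logMultipleGamma (n + 1)) 1) z
  have h2 : (fun z => logMultipleGamma (n + 1) (z + 1)) =ᶠ[nhds z]
      logMultipleGamma (n + 1) + logMultipleGamma n := by
    filter_upwards [isOpen_add_one_slitPlane.mem_nhds hz] with y hy
    exact logMultipleGamma_add_one n hy
  rw [← h1, h2.iteratedDeriv_eq, iteratedDeriv_add (contDiffAt_logMultipleGamma _ hz)
    (contDiffAt_logMultipleGamma _ hz)]

/-- A Cauchy estimate on discs of radius `x / 2` around `x`. -/
theorem tendsto_iteratedDeriv_logMultipleGamma (n : ℕ) {N : ℕ} (hN : n + 1 ≤ N) :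
    Tendsto (fun x : ℝ => iteratedDeriv N (logMultipleGamma n) x) atTop (nhds 0) := by
  have hlo := isLittleO_logMultipleGamma n (δ := Real.pi / 3) (by positivity)
    (by linarith [Real.pi_pos])
  rw [Metric.tendsto_atTop]
  intro ε hε
  have hfac : (0 : ℝ) < N.factorial := by exact_mod_cast Nat.factorial_pos N
  have hev := hlo.def (c := ε / (2 * (N.factorial * 3 ^ N))) (by positivity)
  rw [sectorAtInfty, eventually_inf_principal, hasBasis_cobounded_norm.eventually_iff] at hev
  obtain ⟨R, -, hR⟩ := hev
  refine ⟨max (2 * R) 2, fun x hx => ?_⟩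
  have hx1 : 2 * R ≤ x := (le_max_left _ _).trans hx
  have hx2 : 2 ≤ x := (le_max_right _ _).trans hx
  have hball : ∀ z ∈ Metric.closedBall (x : ℂ) (x / 2), x / 2 ≤ z.re ∧ ‖z‖ ≤ 3 * (x / 2) := by
    intro z hz
    rw [Metric.mem_closedBall, dist_eq_norm] at hz
    have h1 := (Complex.abs_re_le_norm (z - x)).trans hz
    rw [Complex.sub_re, Complex.ofReal_re] at h1
    have h2 := norm_add_le (z - x) x
    rw [sub_add_cancel, Complex.norm_real, Real.norm_of_nonneg (by linarith)] at h2
    exact ⟨by linarith [(abs_le.1 h1).1], by linarith⟩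
  have hdiff : DiffContOnCl ℂ (logMultipleGamma n) (Metric.ball (x : ℂ) (x / 2)) := by
    refine DifferentiableOn.diffContOnCl_ball (U := {z | z + 1 ∈ Complex.slitPlane})
      (differentiableOn_logMultipleGamma n) fun z hz => ?_
    have := (hball z hz).1
    rw [Set.mem_ofPred_eq, Complex.mem_slitPlane_iff]
    left
    simp
    linarith
  have hC : ∀ z ∈ Metric.sphere (x : ℂ) (x / 2), ‖logMultipleGamma n z‖
      ≤ ε / (2 * (N.factorial * 3 ^ N)) * (3 * (x / 2)) ^ N := by
    intro z hz
    obtain ⟨h1, h2⟩ := hball z (Metric.sphere_subset_closedBall hz)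
    have h3 : x / 2 ≤ ‖z‖ := h1.trans (Complex.re_le_norm z)
    have harg : z ∈ stirlingSector (Real.pi / 3) := by
      have := Complex.abs_arg_le_pi_div_two_iff.2 (by linarith : 0 ≤ z.re)
      show |Complex.arg z| < _
      linarith [Real.pi_pos]
    refine (hR (show R ≤ ‖z‖ by linarith) harg).trans ?_
    refine mul_le_mul_of_nonneg_left ?_ (by positivity)
    rw [norm_pow, norm_norm]
    exact (pow_le_pow_left₀ (norm_nonneg _) h2 _).trans
      (pow_le_pow_right₀ (by linarith) hN)
  have h := Complex.norm_iteratedDeriv_le_of_forall_mem_sphere_norm_le N (by linarith) hdiff hC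
  rw [dist_zero_right]
  refine h.trans_lt ?_
  have hxN : (0 : ℝ) < (x / 2) ^ N := by positivity
  rw [mul_pow, div_lt_iff₀ hxN]
  have : (N.factorial : ℝ) * (ε / (2 * (N.factorial * 3 ^ N)) * (3 ^ N * (x / 2) ^ N))
      = ε / 2 * (x / 2) ^ N := by
    field_simp
  rw [this]
  exact mul_lt_mul_of_pos_right (by linarith) hxN

theorem neg_one_pow_mul_descPochhammer_eval_neg_one (i : ℕ) :
    (-1) ^ i * (descPochhammer ℂ i).eval (-1) = (i.factorial : ℂ) := by
  induction i with
  | zero => simp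
  | succ i ih =>
    rw [descPochhammer_succ_eval, Nat.factorial_succ, Nat.cast_mul, ← ih]
    push_cast
    ring

/-- The derivatives of `log Gₙ(x + 1)` of order beyond `n` alternate in sign: up to the sign
`(-1) ^ i` they decrease along `x + ℕ`, by the same property of `log Gₙ₋₁`, and tend to zero. -/
theorem neg_one_pow_mul_iteratedDeriv_logMultipleGamma_nonneg (n : ℕ) :
    ∀ (i : ℕ) (x : ℝ), 0 ≤ x →
      0 ≤ (-1) ^ i * (iteratedDeriv (n + 1 + i) (logMultipleGamma n) x).re := by
  induction n with
  | zero =>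
    intro i x hx
    have hseq := iteratedDeriv_eq_of_hasDerivAt (a := fun i z => powLogSeq 0 (i + 1) (z + 1))
      isOpen_add_one_slitPlane (fun i z hz =>
      (hasDerivAt_powLogSeq 0 (i + 1) hz).comp_add_const z 1)
      (i + 1) (ofReal_add_one_mem_slitPlane (by linarith : -1 < x))
    have h0 : (fun z => powLogSeq 0 (0 + 1) (z + 1)) = logMultipleGamma 0 := by
      ext z
      simp [powLogSeq, logMultipleGamma]
    rw [h0, powLogSeq_of_lt (by omega)] at hseq
    rw [zero_add, add_comm 1 i, hseq]
    have hder : (Polynomial.derivative (descPochhammer ℂ (i + 1))).eval ((0 : ℕ) : ℂ)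
        = (descPochhammer ℂ i).eval (-1) := by
      rw [descPochhammer_succ_left]
      simp
    have hre : (-1 : ℂ) ^ i * ((Polynomial.derivative (descPochhammer ℂ (i + 1))).eval ((0 : ℕ) : ℂ)
        * (((x : ℂ) + 1) ^ (i + 1 - 0))⁻¹)
        = ((i.factorial * ((x + 1) ^ (i + 1))⁻¹ : ℝ) : ℂ) := by
      rw [hder, ← mul_assoc, neg_one_pow_mul_descPochhammer_eval_neg_one]
      push_cast
      rfl
    have h2 := congrArg Complex.re hre
    rw [Complex.ofReal_re] at h2
    have h3 : ((-1 : ℂ) ^ i) = (((-1 : ℝ) ^ i : ℝ) : ℂ) := by push_cast; rfl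
    rw [h3, Complex.re_ofReal_mul] at h2
    rw [h2]
    positivity
  | succ n ih =>
    intro i x hx
    set b : ℕ → ℝ := fun k =>
      (-1) ^ i * (iteratedDeriv (n + 1 + 1 + i) (logMultipleGamma (n + 1)) ((x + k : ℝ) : ℂ)).re
      with hb
    have hanti : Antitone b := by
      refine antitone_nat_of_succ_le fun k => ?_
      have hk : (0 : ℝ) ≤ x + k := by positivity
      have h1 := iteratedDeriv_logMultipleGamma_add_one n (n + 1 + 1 + i)
        (ofReal_add_one_mem_slitPlane (by linarith : -1 < x + k))
      have h2 := ih (i + 1) (x + k) hk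
      have h3 : ((x + (k + 1 : ℕ) : ℝ) : ℂ) = ((x + k : ℝ) : ℂ) + 1 := by push_cast; ring
      simp only [hb]
      rw [h3, h1, Complex.add_re]
      rw [show n + 1 + (i + 1) = n + 1 + 1 + i by ring, pow_succ] at h2
      linarith
    have hlim : Tendsto b atTop (nhds 0) := by
      have h1 := (tendsto_iteratedDeriv_logMultipleGamma (n + 1) (N := n + 1 + 1 + i)
        (by omega)).comp (tendsto_atTop_add_const_left _ x tendsto_natCast_atTop_atTop)
      have h2 := ((Complex.continuous_re.tendsto 0).comp h1).const_mul ((-1 : ℝ) ^ i)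
      rw [Complex.zero_re, mul_zero] at h2
      exact h2
    have := hanti.le_of_tendsto hlim 0
    simpa [hb] using this

theorem iteratedDeriv_re_comp_ofReal {f : ℂ → ℂ} {s : Set ℂ} (hs : IsOpen s)
    (hf : DifferentiableOn ℂ f s) (k : ℕ) {x : ℝ} (hx : (x : ℂ) ∈ s) :
    iteratedDeriv k (fun y : ℝ => (f y).re) x = (iteratedDeriv k f x).re := by
  have h := iteratedDeriv_eq_of_hasDerivAt (a := fun i (y : ℝ) => (iteratedDeriv i f y).re)
    (s := (fun y : ℝ => (y : ℂ)) ⁻¹' s) (hs.preimage Complex.continuous_ofReal)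
    (fun i y hy => ?_) k hx
  · simpa only [iteratedDeriv_zero] using h
  · have hd : DifferentiableAt ℂ (iteratedDeriv i f) y := by
      have han : AnalyticAt ℂ f y := hf.analyticAt (hs.mem_nhds hy)
      rw [iteratedDeriv_eq_iterate]
      exact (han.iterated_deriv i).differentiableAt
    have := hd.hasDerivAt.real_of_complex
    rwa [← iteratedDeriv_succ] at this

/-! ### Uniqueness of solutions of a difference equation -/

theorem AnalyticAt.hasDerivAt_iteratedDeriv {f : ℝ → ℝ} {x : ℝ} (hf : AnalyticAt ℝ f x) (i : ℕ) :
    HasDerivAt (iteratedDeriv i f) (iteratedDeriv (i + 1) f x) x := by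
  rw [iteratedDeriv_succ]
  refine DifferentiableAt.hasDerivAt ?_
  rw [iteratedDeriv_eq_iterate]
  exact (hf.iterated_deriv i).differentiableAt

theorem iteratedDeriv_add_one_of_difference {u g : ℝ → ℝ} (hu : ∀ x, 0 < x → AnalyticAt ℝ u x)
    (hg : ∀ x, 0 < x → u (x + 1) = u x + g x) (i : ℕ) {x : ℝ} (hx : 0 < x) :
    iteratedDeriv i u (x + 1) = iteratedDeriv i u x + iteratedDeriv i g x := by
  have h1 := congrFun (iteratedDeriv_comp_add_const i u 1) x
  have hev : ∀ᶠ y in nhds x, 0 < y := lt_mem_nhds hx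
  have hshift : AnalyticAt ℝ (fun y => u (y + 1)) x :=
    (hu (x + 1) (by linarith)).comp (f := fun y => y + 1) (by fun_prop)
  have hga : AnalyticAt ℝ g x :=
    (hshift.sub (hu x hx)).congr (hev.mono fun y hy => by simp [hg y hy])
  have h2 : (fun y => u (y + 1)) =ᶠ[nhds x] u + g := hev.mono fun y hy => hg y hy
  rw [← h1, h2.iteratedDeriv_eq, iteratedDeriv_add (hu x hx).contDiffAt hga.contDiffAt]

/-- Two solutions of `u (x + 1) = u x + g x` whose derivatives of order `k + 1` are nonnegative
differ by a constant when the derivative of order `k` of `g` tends to zero: the derivative of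
order `k` of the difference is periodic, and its oscillation is bounded by that derivative of `g`
arbitrarily far out. -/
theorem exists_sub_eq_const_of_difference {u v g : ℝ → ℝ} {k : ℕ}
    (hu : ∀ x, 0 < x → AnalyticAt ℝ u x) (hv : ∀ x, 0 < x → AnalyticAt ℝ v x)
    (hug : ∀ x, 0 < x → u (x + 1) = u x + g x) (hvg : ∀ x, 0 < x → v (x + 1) = v x + g x)
    (hu0 : ∀ x, 0 < x → 0 ≤ iteratedDeriv (k + 1) u x)
    (hv0 : ∀ x, 0 < x → 0 ≤ iteratedDeriv (k + 1) v x)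
    (hg0 : Tendsto (iteratedDeriv k g) atTop (nhds 0)) :
    ∃ c, ∀ x, 0 < x → u x - v x = c := by
  set p : ℕ → ℝ → ℝ := fun i x => iteratedDeriv i u x - iteratedDeriv i v x with hp
  have hder : ∀ i x, 0 < x → HasDerivAt (p i) (p (i + 1) x) x := fun i x hx =>
    ((hu x hx).hasDerivAt_iteratedDeriv i).sub ((hv x hx).hasDerivAt_iteratedDeriv i)
  have hper : ∀ i x, 0 < x → p i (x + 1) = p i x := fun i x hx => by
    simp only [hp, iteratedDeriv_add_one_of_difference hu hug i hx,
      iteratedDeriv_add_one_of_difference hv hvg i hx]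
    ring
  have hmono : ∀ f : ℝ → ℝ, (∀ x, 0 < x → AnalyticAt ℝ f x) →
      (∀ x, 0 < x → 0 ≤ iteratedDeriv (k + 1) f x) →
      MonotoneOn (iteratedDeriv k f) (Set.Ioi 0) := fun f hf hf0 => by
    refine monotoneOn_of_hasDerivWithinAt_nonneg (convex_Ioi 0)
      (f' := iteratedDeriv (k + 1) f) (fun x hx => ?_) (fun x hx => ?_) (fun x hx => ?_)
    · exact ((hf x hx).hasDerivAt_iteratedDeriv k).continuousAt.continuousWithinAt
    · rw [interior_Ioi] at hx
      exact ((hf x hx).hasDerivAt_iteratedDeriv k).hasDerivWithinAt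
    · rw [interior_Ioi] at hx
      exact hf0 x hx
  have hosc : ∀ x y, 0 < x → x ≤ y → y ≤ x + 1 → |p k y - p k x| ≤ iteratedDeriv k g x := by
    intro x y hx hxy hyx
    have hy : 0 < y := by linarith
    have hx1 : 0 < x + 1 := by linarith
    have a1 := hmono u hu hu0 hx hy hxy
    have a2 := hmono u hu hu0 hy hx1 hyx
    have b1 := hmono v hv hv0 hx hy hxy
    have b2 := hmono v hv hv0 hy hx1 hyx
    rw [iteratedDeriv_add_one_of_difference hu hug k hx] at a2
    rw [iteratedDeriv_add_one_of_difference hv hvg k hx] at b2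
    simp only [hp]
    rw [abs_le]
    constructor <;> linarith
  have hperN : ∀ i x, 0 < x → ∀ N : ℕ, p i (x + N) = p i x := by
    intro i x hx N
    induction N with
    | zero => simp
    | succ N ih =>
      push_cast
      rw [← add_assoc, hper i _ (by positivity), ih]
  have hconst : ∀ x y, 0 < x → x ≤ y → y ≤ x + 1 → p k y = p k x := by
    intro x y hx hxy hyx
    have h1 : ∀ N : ℕ, |p k y - p k x| ≤ iteratedDeriv k g (x + N) := fun N => by
      rw [← hperN k x hx N, ← hperN k y (by linarith) N]
      exact hosc _ _ (by positivity) (by linarith) (by linarith)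
    have h2 := hg0.comp (tendsto_atTop_add_const_left _ x tendsto_natCast_atTop_atTop)
    have h3 := ge_of_tendsto' h2 h1
    exact sub_eq_zero.1 (abs_eq_zero.1 (le_antisymm h3 (abs_nonneg _)))
  have hzero : ∀ d, d ≤ k → ∀ x, 0 < x → p (k + 1 - d) x = 0 := by
    intro d
    induction d with
    | zero =>
      intro _ x hx
      have h1 : p k =ᶠ[nhds x] fun _ => p k x := by
        filter_upwards [Ioo_mem_nhds (show max 0 (x - 1) < x by simp [hx])
          (show x < x + 1 by linarith)] with y hy
        have hy0 : 0 < y := (le_max_left _ _).trans_lt hy.1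
        have hy1 : x - 1 < y := (le_max_right _ _).trans_lt hy.1
        rcases le_total x y with h | h
        · exact hconst x y hx h hy.2.le
        · exact (hconst y x hy0 h (by linarith)).symm
      exact (hder k x hx).unique ((hasDerivAt_const x (p k x)).congr_of_eventuallyEq h1)
    | succ d ih =>
      intro hd x hx
      have hd' : k + 1 - d = k + 1 - (d + 1) + 1 := by omega
      have ih := ih (by omega)
      rw [hd'] at ih
      set i := k + 1 - (d + 1) with hi
      obtain ⟨j, hj⟩ : ∃ j, i = j + 1 := ⟨i - 1, by omega⟩
      -- `p i` is constant, and it vanishes somewhere by Rolle's theorem for the periodic `p j`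
      obtain ⟨c, hc⟩ := isOpen_Ioi.exists_is_const_of_deriv_eq_zero isPreconnected_Ioi
        (f := p i) (s := Set.Ioi 0)
        (fun y hy => (hder i y hy).differentiableAt.differentiableWithinAt)
        (fun y hy => by rw [(hder i y hy).deriv, ih y hy]; rfl)
      obtain ⟨ξ, hξ, hξ0⟩ := exists_hasDerivAt_eq_zero (f := p j) (f' := p (j + 1))
        (a := 1) (b := 1 + 1) (by norm_num)
        (fun y hy => (hder j y (by linarith [hy.1])).continuousAt.continuousWithinAt)
        (hper j 1 one_pos).symm (fun y hy => hder j y (by linarith [hy.1]))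
      rw [hc x hx, ← hc ξ (show 0 < ξ by linarith [hξ.1]), hj, hξ0]
  obtain ⟨c, hc⟩ := isOpen_Ioi.exists_is_const_of_deriv_eq_zero isPreconnected_Ioi
    (f := p 0) (s := Set.Ioi 0)
    (fun y hy => (hder 0 y hy).differentiableAt.differentiableWithinAt)
    (fun y hy => by
      have := hzero k le_rfl y hy
      rw [Nat.add_sub_cancel_left] at this
      rw [(hder 0 y hy).deriv, this]; rfl)
  exact ⟨c, fun x hx => by simpa [hp] using hc x hx⟩

/-! ### The domain of the multiple gamma functions -/

theorem isOpen_gammaDomain : IsOpen gammaDomain := by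
  have h1 : IsClosed (Set.range fun k : ℕ => (k : ℂ)) := by
    have := (Complex.isometry_ofReal.isClosedEmbedding.comp
      Nat.isClosedEmbedding_coe_real).isClosed_range
    simpa [Function.comp_def] using this
  have h2 : gammaDomain = ((fun z : ℂ => -z) ⁻¹' Set.range fun k : ℕ => (k : ℂ))ᶜ := by
    ext z
    simp only [gammaDomain, Set.mem_ofPred_eq, Set.mem_compl_iff, Set.mem_preimage, Set.mem_range,
      not_exists]
    refine forall_congr' fun k => not_congr ?_
    rw [eq_neg_iff_add_eq_zero, eq_neg_iff_add_eq_zero, add_comm]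
  rw [h2]
  exact (h1.preimage continuous_neg).isOpen_compl

theorem isPreconnected_gammaDomain : IsPreconnected gammaDomain := by
  have h1 : gammaDomain = (Set.range fun k : ℕ => -(k : ℂ))ᶜ := by
    ext z
    simp only [gammaDomain, Set.mem_ofPred_eq, Set.mem_compl_iff, Set.mem_range, not_exists]
    exact forall_congr' fun k => not_congr eq_comm
  rw [h1]
  exact ((Set.countable_range _).isPathConnected_compl_of_one_lt_rank
    (Complex.rank_real_complex ▸ Nat.one_lt_ofNat)).isConnected.isPreconnected

theorem slitPlane_subset_gammaDomain : Complex.slitPlane ⊆ gammaDomain := by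
  rintro z hz k rfl
  rw [Complex.mem_slitPlane_iff] at hz
  simp at hz
  linarith [(Nat.cast_nonneg k : (0 : ℝ) ≤ k)]

theorem add_natCast_mem_gammaDomain {z : ℂ} (hz : z ∈ gammaDomain) (k : ℕ) :
    z + k ∈ gammaDomain := fun l h => hz (l + k) (by
  push_cast
  linear_combination h)

theorem add_natCast_mem_slitPlane {z : ℂ} {k l : ℕ} (hz : z + k ∈ Complex.slitPlane) (h : k ≤ l) :
    z + l ∈ Complex.slitPlane := by
  obtain ⟨d, rfl⟩ := Nat.exists_eq_add_of_le h
  have := add_ofReal_mem_slitPlane hz (Nat.cast_nonneg d)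
  push_cast at this ⊢
  rwa [← add_assoc]

theorem re_add_ceil_pos (z : ℂ) : 0 < (z + (⌈|z.re|⌉₊ + 1 : ℕ)).re := by
  have h1 := Nat.le_ceil |z.re|
  have h2 := neg_abs_le z.re
  push_cast
  simp
  linarith

/-! ### Existence of the multiple gamma functions -/

/-- The multiple gamma functions: `exp` of `logMultipleGamma n (z - 1)` on the slit plane, continued
to the left by dividing by the values of the preceding function. -/
noncomputable def gammaHierarchy : ℕ → ℂ → ℂ
  | 0 => fun z => z
  | n + 1 => fun z => Complex.exp (logMultipleGamma (n + 1) (z + (⌈|z.re|⌉₊ + 1 : ℕ) - 1))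
      / ∏ k ∈ Finset.range (⌈|z.re|⌉₊ + 1), gammaHierarchy n (z + k)

/-- Nonvanishing and agreement with `exp (logMultipleGamma n (z - 1))` in level `n` are what
makes the value in level `n + 1` independent of the shift `N`, so the three facts are proved
together. -/
theorem gammaHierarchy_aux (n : ℕ) :
    (∀ z ∈ gammaDomain, gammaHierarchy n z ≠ 0) ∧
    (∀ z ∈ Complex.slitPlane, gammaHierarchy n z = Complex.exp (logMultipleGamma n (z - 1))) ∧
    (∀ z ∈ gammaDomain, ∀ N : ℕ, z + N ∈ Complex.slitPlane →
      gammaHierarchy (n + 1) z = Complex.exp (logMultipleGamma (n + 1) (z + N - 1))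
        / ∏ k ∈ Finset.range N, gammaHierarchy n (z + k)) := by
  -- the value of the quotient does not depend on how far to the right it is anchored
  have key : ∀ n, (∀ z ∈ gammaDomain, gammaHierarchy n z ≠ 0) →
      (∀ z ∈ Complex.slitPlane, gammaHierarchy n z = Complex.exp (logMultipleGamma n (z - 1))) →
      (∀ z ∈ gammaDomain, ∀ N : ℕ, z + N ∈ Complex.slitPlane →
        gammaHierarchy (n + 1) z = Complex.exp (logMultipleGamma (n + 1) (z + N - 1))
          / ∏ k ∈ Finset.range N, gammaHierarchy n (z + k)) := by
    intro n h0 h1 z hz N hN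
    have hind : ∀ N M : ℕ, z + N ∈ Complex.slitPlane → N ≤ M →
        Complex.exp (logMultipleGamma (n + 1) (z + M - 1))
          / ∏ k ∈ Finset.range M, gammaHierarchy n (z + k)
        = Complex.exp (logMultipleGamma (n + 1) (z + N - 1))
          / ∏ k ∈ Finset.range N, gammaHierarchy n (z + k) := by
      intro N M hN hNM
      induction M, hNM using Nat.le_induction with
      | base => rfl
      | succ M hM ih =>
        have hM' := add_natCast_mem_slitPlane hN hM
        have h2 := logMultipleGamma_add_one n (z := z + M - 1) (by rwa [sub_add_cancel])
        rw [← ih, Finset.prod_range_succ, h1 _ hM',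
          show z + (M + 1 : ℕ) - 1 = z + M - 1 + 1 by push_cast; ring, h2, Complex.exp_add]
        exact mul_div_mul_right _ _ (Complex.exp_ne_zero _)
    have hN' : z + (⌈|z.re|⌉₊ + 1 : ℕ) ∈ Complex.slitPlane := by
      rw [Complex.mem_slitPlane_iff]
      exact Or.inl (re_add_ceil_pos z)
    rw [← hind N _ hN (le_max_left N (⌈|z.re|⌉₊ + 1)), hind _ _ hN' (le_max_right N _)]
    rfl
  induction n with
  | zero =>
    have h0 : ∀ z ∈ gammaDomain, gammaHierarchy 0 z ≠ 0 := fun z hz h =>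
      hz 0 (by simpa [gammaHierarchy] using h)
    have h1 : ∀ z ∈ Complex.slitPlane,
        gammaHierarchy 0 z = Complex.exp (logMultipleGamma 0 (z - 1)) := fun z hz => by
      simp [gammaHierarchy, logMultipleGamma, Complex.exp_log (Complex.slitPlane_ne_zero hz)]
    exact ⟨h0, h1, key 0 h0 h1⟩
  | succ n ih =>
    obtain ⟨h0, h1, h2⟩ := ih
    have h0' : ∀ z ∈ gammaDomain, gammaHierarchy (n + 1) z ≠ 0 := fun z hz =>
      div_ne_zero (Complex.exp_ne_zero _)
        (Finset.prod_ne_zero_iff.2 fun k _ => h0 _ (add_natCast_mem_gammaDomain hz k))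
    have h1' : ∀ z ∈ Complex.slitPlane,
        gammaHierarchy (n + 1) z = Complex.exp (logMultipleGamma (n + 1) (z - 1)) := fun z hz => by
      simpa using h2 z (slitPlane_subset_gammaDomain hz) 0 (by simpa using hz)
    exact ⟨h0', h1', key (n + 1) h0' h1'⟩

theorem gammaHierarchy_ne_zero (n : ℕ) {z : ℂ} (hz : z ∈ gammaDomain) : gammaHierarchy n z ≠ 0 :=
  (gammaHierarchy_aux n).1 z hz

theorem gammaHierarchy_eq_exp (n : ℕ) {z : ℂ} (hz : z ∈ Complex.slitPlane) :
    gammaHierarchy n z = Complex.exp (logMultipleGamma n (z - 1)) :=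
  (gammaHierarchy_aux n).2.1 z hz

theorem gammaHierarchy_succ_eq (n : ℕ) {z : ℂ} (hz : z ∈ gammaDomain) {N : ℕ}
    (hN : z + N ∈ Complex.slitPlane) :
    gammaHierarchy (n + 1) z = Complex.exp (logMultipleGamma (n + 1) (z + N - 1))
      / ∏ k ∈ Finset.range N, gammaHierarchy n (z + k) :=
  (gammaHierarchy_aux n).2.2 z hz N hN

theorem differentiableOn_gammaHierarchy (n : ℕ) :
    DifferentiableOn ℂ (gammaHierarchy n) gammaDomain := by
  induction n with
  | zero => exact differentiableOn_id
  | succ n ih =>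
    intro z hz
    refine DifferentiableAt.differentiableWithinAt ?_
    set N := ⌈|z.re|⌉₊ + 1
    have hev : gammaHierarchy (n + 1) =ᶠ[nhds z] fun z =>
        Complex.exp (logMultipleGamma (n + 1) (z + N - 1))
          / ∏ k ∈ Finset.range N, gammaHierarchy n (z + k) := by
      have h1 : ∀ᶠ y : ℂ in nhds z, 0 < (y + N).re :=
        (isOpen_lt continuous_const (by fun_prop : Continuous fun y : ℂ => (y + N).re)).mem_nhds
          (re_add_ceil_pos z)
      filter_upwards [h1, isOpen_gammaDomain.mem_nhds hz] with y hy hyD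
      exact gammaHierarchy_succ_eq n hyD (Complex.mem_slitPlane_iff.2 (Or.inl hy))
    refine DifferentiableAt.congr_of_eventuallyEq ?_ hev
    refine DifferentiableAt.div ?_ (DifferentiableAt.fun_finsetProd fun k _ => ?_) ?_
    · refine DifferentiableAt.cexp ?_
      have h1 : DifferentiableAt ℂ (logMultipleGamma (n + 1)) (z + N - 1) := by
        refine (differentiableOn_logMultipleGamma (n + 1)).differentiableAt
          (isOpen_add_one_slitPlane.mem_nhds ?_)
        show z + N - 1 + 1 ∈ Complex.slitPlane
        rw [sub_add_cancel, Complex.mem_slitPlane_iff]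
        exact Or.inl (re_add_ceil_pos z)
      exact h1.comp (f := fun z : ℂ => z + N - 1) z (by fun_prop)
    · have h1 : DifferentiableAt ℂ (gammaHierarchy n) (z + k) :=
        ih.differentiableAt (isOpen_gammaDomain.mem_nhds (add_natCast_mem_gammaDomain hz k))
      exact h1.comp (f := fun z : ℂ => z + k) z (by fun_prop)
    · exact Finset.prod_ne_zero_iff.2 fun k _ =>
        gammaHierarchy_ne_zero n (add_natCast_mem_gammaDomain hz k)

theorem gammaHierarchy_ofReal_add_one (n : ℕ) {x : ℝ} (hx : -1 < x) :
    gammaHierarchy n (x + 1) = (Real.exp (logMultipleGamma n x).re : ℂ) := by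
  rw [gammaHierarchy_eq_exp n (ofReal_add_one_mem_slitPlane hx), add_sub_cancel_right,
    Complex.ofReal_exp]
  congr 1
  refine Complex.ext rfl ?_
  simpa using logMultipleGamma_ofReal_im n hx

theorem log_gammaHierarchy_re (n : ℕ) {x : ℝ} (hx : -1 < x) :
    Real.log (gammaHierarchy n (x + 1)).re = (logMultipleGamma n x).re := by
  rw [gammaHierarchy_ofReal_add_one n hx, Complex.ofReal_re, Real.log_exp]

theorem iteratedDeriv_log_gammaHierarchy (n k : ℕ) {x : ℝ} (hx : -1 < x) :
    iteratedDeriv k (fun y : ℝ => Real.log (gammaHierarchy n ((y : ℂ) + 1)).re) x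
      = (iteratedDeriv k (logMultipleGamma n) x).re := by
  have h : (fun y : ℝ => Real.log (gammaHierarchy n ((y : ℂ) + 1)).re) =ᶠ[nhds x]
      fun y : ℝ => (logMultipleGamma n y).re := by
    filter_upwards [lt_mem_nhds hx] with y hy using log_gammaHierarchy_re n hy
  rw [h.iteratedDeriv_eq, iteratedDeriv_re_comp_ofReal isOpen_add_one_slitPlane
    (differentiableOn_logMultipleGamma n) k (ofReal_add_one_mem_slitPlane hx)]

theorem isMultipleGammaHierarchy_gammaHierarchy : IsMultipleGammaHierarchy gammaHierarchy where
  holomorphic := differentiableOn_gammaHierarchy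
  zero_eq _ _ := rfl
  one_eq n := by
    rw [gammaHierarchy_eq_exp n Complex.one_mem_slitPlane, sub_self, logMultipleGamma_zero_right,
      Complex.exp_zero]
  functional_eq n z hz := by
    set N := ⌈|z.re|⌉₊ + 1
    have hN : z + N ∈ Complex.slitPlane :=
      Complex.mem_slitPlane_iff.2 (Or.inl (re_add_ceil_pos z))
    have hN1 := add_natCast_mem_slitPlane hN (Nat.le_succ N)
    have h1 : z + 1 ∈ gammaDomain := by simpa using add_natCast_mem_gammaDomain hz 1
    have hcast : z + (N + 1 : ℕ) = z + 1 + N := by push_cast; ring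
    have hprod : ∏ k ∈ Finset.range (N + 1), gammaHierarchy n (z + k)
        = (∏ k ∈ Finset.range N, gammaHierarchy n (z + 1 + k)) * gammaHierarchy n z := by
      rw [Finset.prod_range_succ']
      simp [add_assoc, add_comm (1 : ℂ)]
    rw [gammaHierarchy_succ_eq n hz hN1, gammaHierarchy_succ_eq n h1 (N := N) (by rwa [← hcast]),
      hprod, hcast]
    have := gammaHierarchy_ne_zero n hz
    field_simp
  real_pos n x hx := by
    rw [gammaHierarchy_ofReal_add_one n (by linarith), Complex.ofReal_im, Complex.ofReal_re]
    exact ⟨rfl, Real.exp_pos _⟩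
  deriv_log_nonneg n x hx := by
    rw [iteratedDeriv_log_gammaHierarchy n _ (by linarith)]
    simpa using neg_one_pow_mul_iteratedDeriv_logMultipleGamma_nonneg n 0 x hx

/-! ### Uniqueness of the multiple gamma functions -/

theorem IsMultipleGammaHierarchy.analyticAt_log {G : ℕ → ℂ → ℂ} (hG : IsMultipleGammaHierarchy G)
    (n : ℕ) {x : ℝ} (hx : 0 ≤ x) :
    AnalyticAt ℝ (fun y : ℝ => Real.log (G n ((y : ℂ) + 1)).re) x := by
  have h1 : AnalyticAt ℂ (G n) ((x : ℂ) + 1) := (hG.holomorphic n).analyticAt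
    (isOpen_gammaDomain.mem_nhds (slitPlane_subset_gammaDomain
      (ofReal_add_one_mem_slitPlane (by linarith))))
  have h2 : AnalyticAt ℂ (fun z => G n (z + 1)) x := h1.comp (f := fun z => z + 1) (by fun_prop)
  exact h2.re_ofReal.log (hG.real_pos n x hx).2

theorem IsMultipleGammaHierarchy.log_add_one {G : ℕ → ℂ → ℂ} (hG : IsMultipleGammaHierarchy G)
    (n : ℕ) {x : ℝ} (hx : 0 ≤ x) :
    Real.log (G (n + 1) (((x + 1 : ℝ) : ℂ) + 1)).re
      = Real.log (G (n + 1) ((x : ℂ) + 1)).re + Real.log (G n ((x : ℂ) + 1)).re := by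
  have h1 := hG.functional_eq n ((x : ℂ) + 1) (slitPlane_subset_gammaDomain
    (ofReal_add_one_mem_slitPlane (by linarith)))
  obtain ⟨h2, h3⟩ := hG.real_pos n x hx
  obtain ⟨h4, h5⟩ := hG.real_pos (n + 1) x hx
  push_cast
  rw [h1, Complex.mul_re, h2, h4, mul_zero, sub_zero, Real.log_mul h3.ne' h5.ne', add_comm]

theorem IsMultipleGammaHierarchy.eqOn_gammaHierarchy {G : ℕ → ℂ → ℂ}
    (hG : IsMultipleGammaHierarchy G) (n : ℕ) : Set.EqOn (G n) (gammaHierarchy n) gammaDomain := by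
  have hG' := isMultipleGammaHierarchy_gammaHierarchy
  induction n with
  | zero => exact fun z hz => by rw [hG.zero_eq z hz, hG'.zero_eq z hz]
  | succ n ih =>
    have hmem : ∀ x : ℝ, -1 < x → (x : ℂ) + 1 ∈ gammaDomain := fun x hx =>
      slitPlane_subset_gammaDomain (ofReal_add_one_mem_slitPlane hx)
    obtain ⟨c, hc⟩ := exists_sub_eq_const_of_difference (k := n + 1)
      (u := fun y : ℝ => Real.log (G (n + 1) ((y : ℂ) + 1)).re)
      (v := fun y : ℝ => Real.log (gammaHierarchy (n + 1) ((y : ℂ) + 1)).re)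
      (g := fun y : ℝ => Real.log (gammaHierarchy n ((y : ℂ) + 1)).re)
      (fun x hx => hG.analyticAt_log (n + 1) hx.le) (fun x hx => hG'.analyticAt_log (n + 1) hx.le)
      (fun x hx => by
        have := hG.log_add_one n hx.le
        rwa [ih (hmem x (by linarith))] at this)
      (fun x hx => hG'.log_add_one n hx.le)
      (fun x hx => hG.deriv_log_nonneg (n + 1) x hx.le)
      (fun x hx => hG'.deriv_log_nonneg (n + 1) x hx.le)
      (by
        have h1 := (Complex.continuous_re.tendsto 0).comp
          (tendsto_iteratedDeriv_logMultipleGamma n le_rfl)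
        rw [Complex.zero_re] at h1
        refine h1.congr' ?_
        filter_upwards [eventually_gt_atTop (-1 : ℝ)] with x hx
        exact (iteratedDeriv_log_gammaHierarchy n (n + 1) hx).symm)
    -- both functions equal `1` at `2`, so the constant vanishes
    have h2 : ∀ {H : ℕ → ℂ → ℂ}, IsMultipleGammaHierarchy H →
      H (n + 1) (((1 : ℝ) : ℂ) + 1) = 1 := by
      intro H hH
      have := hH.functional_eq n 1 (slitPlane_subset_gammaDomain Complex.one_mem_slitPlane)
      rw [hH.one_eq, hH.one_eq, one_mul] at this
      simpa using this
    have hc0 : c = 0 := by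
      rw [← hc 1 one_pos, h2 hG, h2 hG', sub_self]
    have heq : ∀ x : ℝ, 0 < x → G (n + 1) ((x : ℂ) + 1) = gammaHierarchy (n + 1) ((x : ℂ) + 1) := by
      intro x hx
      obtain ⟨h3, h4⟩ := hG.real_pos (n + 1) x hx.le
      obtain ⟨h5, h6⟩ := hG'.real_pos (n + 1) x hx.le
      have h7 := hc x hx
      rw [hc0, sub_eq_zero] at h7
      exact Complex.ext (Real.log_injOn_pos h4 h6 h7) (h3.trans h5.symm)
    refine
      ((hG.holomorphic (n + 1)).analyticOnNhd isOpen_gammaDomain).eqOn_of_preconnected_of_frequently_eq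
      ((hG'.holomorphic (n + 1)).analyticOnNhd isOpen_gammaDomain) isPreconnected_gammaDomain
      (z₀ := ((1 : ℝ) : ℂ) + 1) (hmem 1 (by norm_num)) ?_
    have htend : Tendsto (fun x : ℝ => (x : ℂ) + 1) (nhdsWithin 1 {1}ᶜ)
        (nhdsWithin (((1 : ℝ) : ℂ) + 1) {((1 : ℝ) : ℂ) + 1}ᶜ) := by
      refine tendsto_nhdsWithin_of_tendsto_nhds_of_eventually_within _ ?_ ?_
      · exact ((by fun_prop : Continuous fun x : ℝ => (x : ℂ) + 1).tendsto 1).mono_left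
          nhdsWithin_le_nhds
      · filter_upwards [self_mem_nhdsWithin] with x hx h
        exact hx (by simpa using h)
    refine htend.frequently (Eventually.frequently ?_)
    exact nhdsWithin_le_nhds ((lt_mem_nhds one_pos).mono fun x hx => heq x hx)

theorem isMultipleGammaHierarchy_multipleGamma : IsMultipleGammaHierarchy multipleGamma :=
  Classical.epsilon_spec ⟨gammaHierarchy, isMultipleGammaHierarchy_gammaHierarchy⟩

theorem isLogMultipleGamma_logMultipleGamma (n : ℕ) :
    IsLogMultipleGamma n (logMultipleGamma n) where
  holomorphic := differentiableOn_logMultipleGamma n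
  exp_eq z hz := by
    rw [isMultipleGammaHierarchy_multipleGamma.eqOn_gammaHierarchy n
      (slitPlane_subset_gammaDomain hz), gammaHierarchy_eq_exp n hz, add_sub_cancel_right]
  zero_eq := logMultipleGamma_zero_right n

/-! ### A summation identity for binomial polynomials -/

theorem sum_Icc_one_eq_sum_range {E : Type*} [AddCommMonoid E] (f : ℕ → E) (n : ℕ) :
    ∑ r ∈ Finset.Icc 1 n, f r = ∑ r ∈ Finset.range n, f (r + 1) := by
  rw [Finset.range_eq_Ico, Finset.sum_Ico_add' f 0 n 1]
  rfl

theorem iterate_derivative_binomPoly_eq_zero {n k : ℕ} (hn : 1 ≤ n) (hk : n ≤ k) :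
    Polynomial.derivative^[k] (binomPoly (n - 1)) = 0 :=
  Polynomial.iterate_derivative_eq_zero ((natDegree_binomPoly_le _).trans_lt (by omega))

/-- The primitive of `C(x, n - 1)` that vanishes at `-1`, in the form of a Taylor expansion. -/
noncomputable def binomPrimitive (n : ℕ) : Polynomial ℂ :=
  ∑ j ∈ Finset.range n, Polynomial.C ((-1) ^ j / ((j + 1).factorial : ℂ))
    * (Polynomial.derivative^[j] (binomPoly (n - 1)) * (Polynomial.X + 1) ^ (j + 1))

theorem binomPrimitive_eval (n : ℕ) (z : ℂ) :
    (binomPrimitive n).eval z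
      = ∑ j ∈ Finset.range n, binomCoeff n j z * ((z + 1) ^ (j + 1) / ((j : ℂ) + 1)) := by
  rw [binomPrimitive, Polynomial.eval_finsetSum]
  refine Finset.sum_congr rfl fun j _ => ?_
  rw [binomCoeff_eq, Nat.factorial_succ]
  have h1 : (j : ℂ) + 1 ≠ 0 := by exact_mod_cast Nat.succ_ne_zero j
  have h2 : (j.factorial : ℂ) ≠ 0 := by exact_mod_cast Nat.factorial_ne_zero _
  simp
  field_simp

theorem derivative_binomPrimitive {n : ℕ} (hn : 1 ≤ n) :
    Polynomial.derivative (binomPrimitive n) = binomPoly (n - 1) := by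
  set S : ℕ → Polynomial ℂ := fun j => Polynomial.C ((-1) ^ j / (j.factorial : ℂ))
    * (Polynomial.derivative^[j] (binomPoly (n - 1)) * (Polynomial.X + 1) ^ j) with hS
  have hterm : ∀ j, Polynomial.derivative (Polynomial.C ((-1) ^ j / ((j + 1).factorial : ℂ))
      * (Polynomial.derivative^[j] (binomPoly (n - 1)) * (Polynomial.X + 1) ^ (j + 1)))
      = S j - S (j + 1) := by
    intro j
    have h1 : (j : ℂ) + 1 ≠ 0 := by exact_mod_cast Nat.succ_ne_zero j
    have h2 : (j.factorial : ℂ) ≠ 0 := by exact_mod_cast Nat.factorial_ne_zero _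
    have h3 : (-1 : ℂ) ^ j / (j.factorial : ℂ)
        = (-1) ^ j / ((j + 1).factorial : ℂ) * ((j : ℂ) + 1) := by
      rw [Nat.factorial_succ]; push_cast; field_simp
    have h4 : (-1 : ℂ) ^ (j + 1) / ((j + 1).factorial : ℂ)
        = -((-1) ^ j / ((j + 1).factorial : ℂ)) := by ring
    have h5 : Polynomial.derivative ((Polynomial.X + 1 : Polynomial ℂ) ^ (j + 1))
        = Polynomial.C ((j : ℂ) + 1) * (Polynomial.X + 1) ^ j := by
      rw [Polynomial.derivative_pow]
      simp
    simp only [hS, h4]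
    rw [h3, Polynomial.derivative_C_mul, Polynomial.derivative_mul, h5,
      ← Function.iterate_succ_apply' Polynomial.derivative, Polynomial.C_mul, Polynomial.C_neg]
    ring
  rw [binomPrimitive, Polynomial.derivative_sum, Finset.sum_congr rfl fun j _ => hterm j,
    Finset.sum_range_sub']
  simp [hS, iterate_derivative_binomPoly_eq_zero hn le_rfl]

/-- Both sides are polynomials in `z` that agree at `z = -1`; by the Euler–Maclaurin formula for
the polynomial `C(x, n - 1)` they have the same increments under `z ↦ z + 1`. -/
theorem sum_binomCoeff_primitive {n : ℕ} (hn : 1 ≤ n) (z : ℂ) :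
    ∑ j ∈ Finset.range n, binomCoeff n j z * ((z + 1) ^ (j + 1) / ((j : ℂ) + 1))
      + ∑ r ∈ Finset.range n,
        (bernoulli (r + 1) : ℂ) / ((r + 1).factorial : ℂ) * binomDeriv n r (-1)
    = (binomPoly n).eval (z + 1)
      + ∑ r ∈ Finset.range n,
        (bernoulli (r + 1) : ℂ) / ((r + 1).factorial : ℂ) * binomDeriv n r z := by
  obtain ⟨k, rfl⟩ := Nat.exists_eq_add_of_le' hn
  rw [← binomPrimitive_eval]
  set c : ℕ → ℂ := fun r => (bernoulli (r + 1) : ℂ) / ((r + 1).factorial : ℂ) with hc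
  set K : ℂ := ∑ r ∈ Finset.range (k + 1), c r * binomDeriv (k + 1) r (-1) with hK
  set Q : Polynomial ℂ := (binomPoly (k + 1)).comp (Polynomial.X + 1)
    + ∑ r ∈ Finset.range (k + 1), Polynomial.C (c r * (-1) ^ r)
      * Polynomial.derivative^[r] (binomPoly k) - Polynomial.C K with hQ
  have hQeval : ∀ x, Q.eval x = (binomPoly (k + 1)).eval (x + 1)
      + ∑ r ∈ Finset.range (k + 1), c r * binomDeriv (k + 1) r x - K := by
    intro x
    simp only [hQ, Polynomial.eval_sub, Polynomial.eval_add, Polynomial.eval_comp,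
      Polynomial.eval_finsetSum, Polynomial.eval_mul, Polynomial.eval_C, Polynomial.eval_X,
      Polynomial.eval_one, binomDeriv, Nat.add_sub_cancel, mul_assoc]
  have hstep : ∀ x : ℂ, (binomPrimitive (k + 1)).eval (x + 1) - (binomPrimitive (k + 1)).eval x
      = Q.eval (x + 1) - Q.eval x := by
    intro x
    have hEM := euler_maclaurin_unit (fun r t => (-1) ^ r
      * (Polynomial.derivative^[r] (binomPrimitive (k + 1))).eval (x + 1 - (t : ℂ)))
      (fun r t _ => by
        have h1 := ((Polynomial.hasDerivAt (Polynomial.derivative^[r] (binomPrimitive (k + 1)))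
          (x + 1 - (t : ℂ))).comp (t : ℂ) ((hasDerivAt_id (t : ℂ)).const_sub (x + 1))).comp_ofReal
        refine (h1.const_mul ((-1) ^ r)).congr_deriv ?_
        rw [Function.iterate_succ_apply', pow_succ]
        ring) k
    have hiter : ∀ r, Polynomial.derivative^[r + 1] (binomPrimitive (k + 1))
        = Polynomial.derivative^[r] (binomPoly k) := fun r => by
      rw [Function.iterate_succ_apply, derivative_binomPrimitive hn, Nat.add_sub_cancel]
    have hzero := iterate_derivative_binomPoly_eq_zero hn le_rfl
    rw [Nat.add_sub_cancel] at hzero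
    rw [Finset.sum_range_succ'] at hEM
    simp only [hiter, hzero, Polynomial.eval_zero, mul_zero, intervalIntegral.integral_zero,
      Complex.ofReal_one, Complex.ofReal_zero, add_sub_cancel_right, sub_zero, add_zero,
      Function.iterate_zero, id_eq, bernoulli_zero, Rat.cast_one, Nat.factorial_zero, Nat.cast_one,
      div_one, one_mul, pow_zero, pow_one] at hEM
    have hpascal := binomPoly_succ_eval_add_one k (x + 1)
    have hsum : ∑ r ∈ Finset.range (k + 1), (bernoulli (r + 1) : ℂ) / ((r + 1).factorial : ℂ)
        * ((-1) ^ (r + 1) * (Polynomial.derivative^[r] (binomPoly k)).eval x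
          - (-1) ^ (r + 1) * (Polynomial.derivative^[r] (binomPoly k)).eval (x + 1))
        = ∑ r ∈ Finset.range (k + 1), c r * binomDeriv (k + 1) r (x + 1)
          - ∑ r ∈ Finset.range (k + 1), c r * binomDeriv (k + 1) r x := by
      rw [← Finset.sum_sub_distrib]
      refine Finset.sum_congr rfl fun r _ => ?_
      simp only [hc, binomDeriv, Nat.add_sub_cancel]
      ring
    rw [hsum] at hEM
    rw [hQeval, hQeval]
    linear_combination -hpascal - hEM
  have hbase : (binomPrimitive (k + 1)).eval (-1) = Q.eval (-1) := by
    rw [hQeval, binomPrimitive_eval, neg_add_cancel, binomPoly_succ_eval_zero]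
    simp [hK]
  have hnat : ∀ N : ℕ, (binomPrimitive (k + 1)).eval (-1 + (N : ℂ)) = Q.eval (-1 + (N : ℂ)) := by
    intro N
    induction N with
    | zero => simpa using hbase
    | succ N ih =>
      have := hstep (-1 + (N : ℂ))
      push_cast
      rw [← add_assoc]
      linear_combination this + ih
  have hinf : (Set.range fun N : ℕ => -1 + (N : ℂ)).Infinite :=
    Set.infinite_range_of_injective fun a b h => by simpa using h
  have heq : binomPrimitive (k + 1) = Q := Polynomial.eq_of_infinite_eval_eq _ _
    (hinf.mono (by rintro _ ⟨N, rfl⟩; exact hnat N))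
  rw [heq, hQeval]
  ring

/-! ### The kernel of the Stirling formula -/

theorem isOpen_ray_preimage (z : ℂ) : IsOpen {t : ℝ | z + (t : ℂ) ∈ Complex.slitPlane} :=
  Complex.isOpen_slitPlane.preimage (by fun_prop : Continuous fun t : ℝ => z + (t : ℂ))

theorem add_ofReal_mem_slitPlane_of_one_le {z : ℂ} (hz : z + 1 ∈ Complex.slitPlane) {t : ℝ}
    (ht : 1 ≤ t) : z + (t : ℂ) ∈ Complex.slitPlane := by
  have := add_ofReal_mem_slitPlane hz (sub_nonneg.2 ht)
  push_cast at this
  rwa [add_add_sub_cancel] at this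

/-- The principal branch is additive here since `z + t` and `z + 1` have equal imaginary parts. -/
theorem log_div_add_one {z : ℂ} (hz : z + 1 ∈ Complex.slitPlane) {t : ℝ}
    (ht : z + (t : ℂ) ∈ Complex.slitPlane) :
    Complex.log ((z + t) / (z + 1)) = Complex.log (z + t) - Complex.log (z + 1) := by
  have h1 := Complex.slitPlane_arg_ne_pi hz
  have h2 := Complex.slitPlane_arg_ne_pi ht
  have h3 : (z + 1).im = z.im := by simp
  have h4 : (z + t).im = z.im := by simp
  rw [div_eq_mul_inv, sub_eq_add_neg, ← Complex.log_inv _ h1, Complex.log_mul_eq_add_log_iff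
    (Complex.slitPlane_ne_zero ht) (inv_ne_zero (Complex.slitPlane_ne_zero hz)), Complex.arg_inv,
    if_neg h1]
  have a1 := Complex.neg_pi_lt_arg (z + 1)
  have a2 := lt_of_le_of_ne (Complex.arg_le_pi (z + 1)) h1
  have b1 := Complex.neg_pi_lt_arg (z + t)
  have b2 := lt_of_le_of_ne (Complex.arg_le_pi (z + t)) h2
  rcases le_or_gt 0 z.im with h | h
  · have a3 := Complex.arg_nonneg_iff.2 (h.trans_eq h3.symm)
    have b3 := Complex.arg_nonneg_iff.2 (h.trans_eq h4.symm)
    constructor <;> linarith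
  · have a3 := Complex.arg_neg_iff.2 (h3.trans_lt h)
    have b3 := Complex.arg_neg_iff.2 (h4.trans_lt h)
    constructor <;> linarith

/-- The derivatives of `C(-t, n - 1)` in terms of the expansion in powers of `u = z + t`. -/
theorem sum_binomCoeff_mul_zpow {n : ℕ} (hn : 1 ≤ n) (k : ℕ) (z : ℂ) {u : ℂ} (hu : u ≠ 0) :
    ∑ j ∈ Finset.range n, binomCoeff n j z
        * ((descPochhammer ℂ k).eval (j : ℂ) * u ^ ((j : ℤ) - k))
      = (-1) ^ k * (Polynomial.derivative^[k] (binomPoly (n - 1))).eval (z - u) := by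
  have h1 := iteratedDeriv_eq_of_hasDerivAt (s := {u : ℂ | u ≠ 0}) isOpen_ne
    (a := fun k u => ∑ j ∈ Finset.range n, binomCoeff n j z
        * ((descPochhammer ℂ k).eval (j : ℂ) * u ^ ((j : ℤ) - k))) (fun i u hu => by
      refine (HasDerivAt.fun_sum fun (j : ℕ) _ =>
        ((hasDerivAt_zpow ((j : ℤ) - i) u (Or.inl hu)).const_mul
        ((descPochhammer ℂ i).eval (j : ℂ))).const_mul (binomCoeff n j z)).congr_deriv ?_
      refine Finset.sum_congr rfl fun j _ => ?_
      rw [descPochhammer_succ_eval]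
      push_cast
      rw [sub_sub]
      ring) k hu
  have h2 := iteratedDeriv_eq_of_hasDerivAt (s := {u : ℂ | u ≠ 0}) isOpen_ne
    (a := fun k u => (-1) ^ k * (Polynomial.derivative^[k] (binomPoly (n - 1))).eval (z - u))
    (fun i u _ => by
      have h := (Polynomial.hasDerivAt (Polynomial.derivative^[i] (binomPoly (n - 1)))
        (z - u)).comp u ((hasDerivAt_id u).const_sub z)
      refine (h.const_mul ((-1) ^ i)).congr_deriv ?_
      rw [Function.iterate_succ_apply', pow_succ]
      ring) k hu
  have h3 : (fun u : ℂ => ∑ j ∈ Finset.range n, binomCoeff n j z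
        * ((descPochhammer ℂ 0).eval (j : ℂ) * u ^ ((j : ℤ) - (0 : ℕ))))
      = fun u => (-1) ^ 0 * (Polynomial.derivative^[0] (binomPoly (n - 1))).eval (z - u) := by
    ext u
    simp [sum_binomCoeff_mul_pow hn]
  rw [← h1, h3, h2]

theorem iteratedDeriv_stirlingKernel {n : ℕ} (hn : 1 ≤ n) (k : ℕ) {z : ℂ}
    (hz : z + 1 ∈ Complex.slitPlane) {t : ℝ} (ht : z + (t : ℂ) ∈ Complex.slitPlane) :
    iteratedDeriv k (stirlingKernel n z) t
      = ∑ j ∈ Finset.range n, binomCoeff n j z * powLogSeq j (k + 1) (z + t)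
        - Complex.log (z + 1)
          * ((-1) ^ k * (Polynomial.derivative^[k] (binomPoly (n - 1))).eval (-(t : ℂ))) := by
  have hopen := isOpen_ray_preimage z
  have h1 := iteratedDeriv_eq_of_hasDerivAt hopen
    (a := fun k (t : ℝ) => ∑ j ∈ Finset.range n, binomCoeff n j z * powLogSeq j (k + 1) (z + t)
        - Complex.log (z + 1)
          * ((-1) ^ k * (Polynomial.derivative^[k] (binomPoly (n - 1))).eval (-(t : ℂ))))
    (fun i t ht => by
      have h2 := HasDerivAt.fun_sum fun j (_ : j ∈ Finset.range n) =>
        (((hasDerivAt_powLogSeq j (i + 1) ht).comp_const_add z (t : ℂ)).comp_ofReal).const_mul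
          (binomCoeff n j z)
      have h3 := ((Polynomial.hasDerivAt (Polynomial.derivative^[i] (binomPoly (n - 1)))
        (-(t : ℂ))).comp (t : ℂ) (hasDerivAt_neg _)).comp_ofReal
      refine (h2.sub ((h3.const_mul ((-1) ^ i)).const_mul (Complex.log (z + 1)))).congr_deriv ?_
      rw [Function.iterate_succ_apply', pow_succ]
      ring) k ht
  refine Eq.trans (Set.EqOn.iteratedDeriv_of_isOpen (fun t ht => ?_) hopen k ht) h1
  have h4 := sum_binomCoeff_mul_pow hn z (z + t)
  rw [sub_add_cancel_left] at h4
  simp only [stirlingKernel, log_div_add_one hz ht, powLogSeq_one, ← mul_assoc, ← Finset.sum_mul,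
    zero_add, h4, Function.iterate_zero, id_eq, pow_zero, one_mul]
  ring

theorem stirlingF_eq {n : ℕ} (hn : 1 ≤ n) (k : ℕ) {z : ℂ} (hz : z + 1 ∈ Complex.slitPlane) :
    stirlingF n k z = ∑ j ∈ Finset.range n, binomCoeff n j z * powLogSeq j (k + 1) (z + 1)
      - Complex.log (z + 1) * binomDeriv n k (-1) := by
  have h := iteratedDeriv_stirlingKernel hn k hz (t := 1) (by simpa using hz)
  rw [Complex.ofReal_one] at h
  exact h

/-- The logarithmic terms cancel in `stirlingF`. -/
theorem stirlingF_eq_sum {n : ℕ} (hn : 1 ≤ n) (k : ℕ) {z : ℂ} (hz : z + 1 ∈ Complex.slitPlane) :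
    stirlingF n k z = ∑ j ∈ Finset.range n, binomCoeff n j z
      * ((Polynomial.derivative (descPochhammer ℂ k)).eval (j : ℂ) * (z + 1) ^ ((j : ℤ) - k)) := by
  have h := sum_binomCoeff_mul_zpow hn k z (Complex.slitPlane_ne_zero hz)
  rw [show z - (z + 1) = -1 by ring] at h
  rw [stirlingF_eq hn k hz, binomDeriv, ← h, Finset.mul_sum, ← Finset.sum_sub_distrib]
  refine Finset.sum_congr rfl fun j _ => ?_
  simp only [powLogSeq]
  ring

theorem stirlingF_zero {n : ℕ} (hn : 1 ≤ n) {z : ℂ} (hz : z + 1 ∈ Complex.slitPlane) :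
    stirlingF n 0 z = 0 := by
  rw [stirlingF_eq_sum hn 0 hz]
  simp

theorem eventually_mem_stirlingSector (δ : ℝ) : ∀ᶠ z in sectorAtInfty δ, z ∈ stirlingSector δ :=
  eventually_inf_principal.2 (Eventually.of_forall fun _ h => h)

theorem isBigO_stirlingF {n : ℕ} (hn : 1 ≤ n) (k : ℕ) {δ : ℝ} (hδ : 0 < δ) :
    stirlingF n k =O[sectorAtInfty δ] fun z : ℂ => ‖z‖ ^ ((n : ℤ) - 1 - k) := by
  have hev : stirlingF n k =ᶠ[sectorAtInfty δ] fun z => ∑ j ∈ Finset.range n, binomCoeff n j z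
      * ((Polynomial.derivative (descPochhammer ℂ k)).eval (j : ℂ) * (z + 1) ^ ((j : ℤ) - k)) :=
    (eventually_mem_stirlingSector δ).mono fun z hz =>
      stirlingF_eq_sum hn k (add_one_mem_slitPlane_of_mem_sector hδ hz)
  refine hev.trans_isBigO (IsBigO.mono (IsBigO.fun_sum fun j _ => ?_) (sectorAtInfty_le δ))
  refine ((isBigO_binomCoeff hn j).mul ((isBigO_add_one_zpow ((j : ℤ) - k)).const_mul_left
    ((Polynomial.derivative (descPochhammer ℂ k)).eval (j : ℂ)))).congr' EventuallyEq.rfl ?_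
  refine (norm_zpow_mul_norm_zpow _ _).trans (Eventually.of_forall fun z => ?_)
  show ‖z‖ ^ _ = ‖z‖ ^ _
  congr 1
  ring

/-! ### The Euler–Maclaurin remainder -/

theorem stirlingRIntegrand_add_one {n m : ℕ} (hn : 1 ≤ n) (hm : n < m) {z : ℂ}
    (hz : z + 1 ∈ Complex.slitPlane) {t : ℝ} (ht : 0 ≤ t) :
    stirlingRIntegrand n m z (1 + t) = ∑ j ∈ Finset.range n, binomCoeff n j z
      * (Polynomial.derivative (descPochhammer ℂ m)).eval (j : ℂ)
      * ((bernoulliFun m (Int.fract t) : ℂ) * ((z + 1 + (t : ℂ)) ^ (m - j))⁻¹) := by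
  have hzt := add_ofReal_mem_slitPlane_of_one_le hz (t := 1 + t) (by linarith)
  rw [stirlingRIntegrand, iteratedDeriv_stirlingKernel hn m hz hzt,
    iterate_derivative_binomPoly_eq_zero hn hm.le, Int.fract_one_add, Polynomial.eval_zero,
    mul_zero, mul_zero, sub_zero, Finset.mul_sum]
  refine Finset.sum_congr rfl fun j hj => ?_
  rw [powLogSeq_of_lt (by have := Finset.mem_range.1 hj; omega)]
  push_cast
  rw [← add_assoc]
  ring

theorem integrableOn_stirlingRIntegrand_summand {n m : ℕ} (hm : n < m) {z : ℂ}
    (hz : z + 1 ∈ Complex.slitPlane) : ∀ j ∈ Finset.range n,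
    MeasureTheory.IntegrableOn (fun t : ℝ => binomCoeff n j z
      * (Polynomial.derivative (descPochhammer ℂ m)).eval (j : ℂ)
      * ((bernoulliFun m (Int.fract t) : ℂ) * ((z + 1 + (t : ℂ)) ^ (m - j))⁻¹)) (Set.Ioi 0) := by
  intro j hj
  obtain ⟨c, hc, hcw⟩ := exists_mul_le_norm_add_ofReal hz
  obtain ⟨k, hk⟩ : ∃ k, m - j = k + 2 := ⟨m - j - 2, by have := Finset.mem_range.1 hj; omega⟩
  rw [hk]
  exact (integrableOn_bernoulliFun_mul_inv m k hc
    (norm_pos_iff.2 (Complex.slitPlane_ne_zero hz)) hcw).const_mul _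

theorem integrableOn_stirlingRIntegrand {n m : ℕ} (hn : 1 ≤ n) (hm : n < m) {z : ℂ}
    (hz : z + 1 ∈ Complex.slitPlane) :
    MeasureTheory.IntegrableOn (stirlingRIntegrand n m z) (Set.Ioi (1 : ℝ)) := by
  have h := integrableOn_Ioi_comp_add_left (stirlingRIntegrand n m z) 0 1
  rw [add_zero] at h
  refine h.1 (MeasureTheory.IntegrableOn.congr_fun (MeasureTheory.integrable_finsetSum _
    (integrableOn_stirlingRIntegrand_summand hm hz)) (fun t ht => ?_) measurableSet_Ioi)
  exact (stirlingRIntegrand_add_one hn hm hz (le_of_lt ht)).symm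

theorem stirlingR_eq {n m : ℕ} (hn : 1 ≤ n) (hm : n < m) {z : ℂ}
    (hz : z + 1 ∈ Complex.slitPlane) :
    stirlingR n m z = (-1) ^ (m + 1) / (m.factorial : ℂ) * ∑ j ∈ Finset.range n, binomCoeff n j z
      * (Polynomial.derivative (descPochhammer ℂ m)).eval (j : ℂ)
      * bernoulliIntegral m (m - j) (z + 1) := by
  have h := integral_Ioi_comp_add_left (stirlingRIntegrand n m z) 0 1
  rw [add_zero] at h
  rw [stirlingR, ← h, MeasureTheory.setIntegral_congr_fun measurableSet_Ioi
    (fun t ht => stirlingRIntegrand_add_one hn hm hz (le_of_lt ht)),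
    MeasureTheory.integral_finsetSum _ (integrableOn_stirlingRIntegrand_summand hm hz)]
  simp only [MeasureTheory.integral_const_mul]
  rfl

theorem isBigO_stirlingR {n m : ℕ} (hn : 1 ≤ n) (hm : n < m) {δ : ℝ} (hδ : 0 < δ)
    (hδ' : δ < Real.pi) :
    stirlingR n m =O[sectorAtInfty δ] fun z : ℂ => ‖z‖ ^ ((n : ℤ) - m + 1) := by
  have hev : stirlingR n m =ᶠ[sectorAtInfty δ] _ :=
    (eventually_mem_stirlingSector δ).mono fun z hz =>
      stirlingR_eq hn hm (add_one_mem_slitPlane_of_mem_sector hδ hz)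
  refine hev.trans_isBigO (IsBigO.const_mul_left (IsBigO.fun_sum fun j hj => ?_) _)
  obtain ⟨k, hk⟩ : ∃ k, m - j = k + 2 := ⟨m - j - 2, by have := Finset.mem_range.1 hj; omega⟩
  rw [hk]
  have h1 := (((isBigO_binomCoeff hn j).mono (sectorAtInfty_le δ)).mul
    (isBigO_const_const ((Polynomial.derivative (descPochhammer ℂ m)).eval (j : ℂ))
      (one_ne_zero : (1 : ℝ) ≠ 0) (sectorAtInfty δ))).mul (isBigO_bernoulliIntegral m k hδ hδ')
  refine h1.trans (IsBigO.mono ?_ (sectorAtInfty_le δ))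
  simp only [mul_one]
  exact (norm_zpow_mul_norm_zpow _ _).trans_isBigO (isBigO_norm_zpow_of_le (by omega))

/-! ### The Stirling formula -/

theorem logMultipleGamma_eq_sum {n m : ℕ} (hn : 1 ≤ n) (hm : n < m) {z : ℂ}
    (hz : z + 1 ∈ Complex.slitPlane) :
    logMultipleGamma n z = ∑ j ∈ Finset.range n, binomCoeff n j z
      * (hurwitzDeriv j m (z + 1) - deriv riemannZeta (-(j : ℂ))) := by
  obtain ⟨k, rfl⟩ := Nat.exists_eq_add_of_le' hn
  refine Finset.sum_congr rfl fun j hj => ?_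
  rw [hurwitzDeriv_eq (m' := m) le_rfl (by have := Finset.mem_range.1 hj; omega) hz]

/-- The Stirling formula with its exact remainder. -/
theorem logMultipleGamma_eq_main_add {n m : ℕ} (hn : 1 ≤ n) (hm : n < m) {z : ℂ}
    (hz : z + 1 ∈ Complex.slitPlane) :
    logMultipleGamma n z = stirlingMain n z
      + ∑ r ∈ Finset.range m, (bernoulli (r + 1) : ℂ) / ((r + 1).factorial : ℂ) * stirlingF n r z
      - stirlingR n m z := by
  set ℓ := Complex.log (z + 1) with hℓ
  set c : ℕ → ℂ := fun r => (bernoulli (r + 1) : ℂ) / ((r + 1).factorial : ℂ) with hc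
  have hH : ∀ j, hurwitzDeriv j m (z + 1) = (z + 1) ^ (j + 1)
        * (ℓ / ((j : ℂ) + 1) - 1 / ((j : ℂ) + 1) ^ 2)
      + ∑ r ∈ Finset.range m, c r * powLogSeq j (r + 1) (z + 1)
      + (-1) ^ m / (m.factorial : ℂ) * ((Polynomial.derivative (descPochhammer ℂ m)).eval (j : ℂ)
        * bernoulliIntegral m (m - j) (z + 1)) := by
    intro j
    rw [hurwitzDeriv, Finset.sum_range_succ']
    simp only [powLogSeq, bernoulli_zero, Nat.factorial_zero]
    push_cast
    ring
  have hF : ∑ j ∈ Finset.range n, binomCoeff n j z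
        * ∑ r ∈ Finset.range m, c r * powLogSeq j (r + 1) (z + 1)
      = ∑ r ∈ Finset.range m, c r * stirlingF n r z
        + ℓ * ∑ r ∈ Finset.range n, c r * binomDeriv n r (-1) := by
    have h1 : ∑ r ∈ Finset.range n, c r * binomDeriv n r (-1)
        = ∑ r ∈ Finset.range m, c r * binomDeriv n r (-1) := by
      refine Finset.sum_subset (Finset.range_subset_range.2 hm.le) fun r _ hr => ?_
      rw [binomDeriv, iterate_derivative_binomPoly_eq_zero hn (by simpa using hr)]
      simp
    rw [h1, Finset.mul_sum, ← Finset.sum_add_distrib]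
    simp only [Finset.mul_sum]
    rw [Finset.sum_comm]
    refine Finset.sum_congr rfl fun r _ => ?_
    rw [stirlingF_eq hn r hz, mul_sub, Finset.mul_sum]
    have : ∀ j, binomCoeff n j z * (c r * powLogSeq j (r + 1) (z + 1))
        = c r * (binomCoeff n j z * powLogSeq j (r + 1) (z + 1)) := fun j => by ring
    simp only [this]
    ring
  have hlog := sum_binomCoeff_primitive hn z
  have hpow : ∑ r ∈ Finset.range n, binomDeriv n r z
        * (1 / (((r + 1).factorial : ℂ) * ((r + 1 : ℕ) : ℂ)) * ((z + 1) ^ (r + 1) - 1))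
      = ∑ j ∈ Finset.range n, binomCoeff n j z
        * ((z + 1) ^ (j + 1) / ((j : ℂ) + 1) ^ 2 - 1 / ((j : ℂ) + 1) ^ 2) := by
    refine Finset.sum_congr rfl fun j _ => ?_
    rw [binomCoeff_eq, binomDeriv, Nat.factorial_succ]
    have h1 : (j : ℂ) + 1 ≠ 0 := by exact_mod_cast Nat.succ_ne_zero j
    have h2 : (j.factorial : ℂ) ≠ 0 := by exact_mod_cast Nat.factorial_ne_zero _
    push_cast
    field_simp
  have hR := stirlingR_eq hn hm hz
  rw [logMultipleGamma_eq_sum hn hm hz, stirlingMain, sum_Icc_one_eq_sum_range,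
    sum_Icc_one_eq_sum_range, hR]
  simp only [Nat.add_sub_cancel]
  rw [hpow, ← hℓ, ← hlog]
  calc _ = ℓ * ∑ j ∈ Finset.range n, binomCoeff n j z * ((z + 1) ^ (j + 1) / ((j : ℂ) + 1))
        - ∑ j ∈ Finset.range n, binomCoeff n j z * ((z + 1) ^ (j + 1) / ((j : ℂ) + 1) ^ 2)
        - ∑ j ∈ Finset.range n, binomCoeff n j z * deriv riemannZeta (-(j : ℂ))
        + ∑ j ∈ Finset.range n, binomCoeff n j z
            * ∑ r ∈ Finset.range m, c r * powLogSeq j (r + 1) (z + 1)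
        + (-1) ^ m / (m.factorial : ℂ) * ∑ j ∈ Finset.range n, binomCoeff n j z
          * (Polynomial.derivative (descPochhammer ℂ m)).eval (j : ℂ)
          * bernoulliIntegral m (m - j) (z + 1) := by
        rw [Finset.mul_sum, Finset.mul_sum, ← Finset.sum_sub_distrib, ← Finset.sum_sub_distrib,
          ← Finset.sum_add_distrib, ← Finset.sum_add_distrib]
        refine Finset.sum_congr rfl fun j _ => ?_
        rw [hH]
        ring
    _ = _ := by
        rw [hF]
        simp only [mul_sub, mul_add, Finset.sum_sub_distrib, Finset.sum_add_distrib]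
        ring

theorem sum_bernoulli_mul_stirlingF {n : ℕ} (hn : 1 ≤ n) (M : ℕ) {z : ℂ}
    (hz : z + 1 ∈ Complex.slitPlane) :
    ∑ r ∈ Finset.range (2 * M + 1),
        (bernoulli (r + 1) : ℂ) / ((r + 1).factorial : ℂ) * stirlingF n r z
      = ∑ r ∈ Finset.Icc 1 M,
        (bernoulli (2 * r) : ℂ) / ((2 * r).factorial : ℂ) * stirlingF n (2 * r - 1) z := by
  rw [sum_Icc_one_eq_sum_range]
  induction M with
  | zero => simp [stirlingF_zero hn hz]
  | succ M ih =>
    have h0 : bernoulli (2 * M + 2 + 1) = 0 :=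
      bernoulli_eq_zero_of_odd ⟨M + 1, by ring⟩ (by omega)
    rw [show 2 * (M + 1) + 1 = 2 * M + 1 + 1 + 1 by ring, Finset.sum_range_succ,
      Finset.sum_range_succ, ih, Finset.sum_range_succ _ M,
      show 2 * M + 1 + 1 + 1 = 2 * M + 2 + 1 by ring,
      h0, show 2 * (M + 1) = 2 * M + 1 + 1 by ring, Nat.add_sub_cancel]
    simp

theorem isBigO_logMultipleGamma_sub {n : ℕ} (hn : 1 ≤ n) (M : ℕ) {δ : ℝ} (hδ : 0 < δ)
    (hδ' : δ < Real.pi) :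
    (fun z : ℂ => logMultipleGamma n z - (stirlingMain n z
        + ∑ r ∈ Finset.Icc 1 M,
            (bernoulli (2 * r) : ℂ) / ((2 * r).factorial : ℂ) * stirlingF n (2 * r - 1) z))
      =O[sectorAtInfty δ] fun z : ℂ => ‖z‖ ^ ((n : ℤ) - 2 * (M : ℤ) - 2) := by
  -- a remainder of order `m` this large is smaller than the first omitted term
  set m := n + 2 * M + 3 with hm
  have hev : (fun z : ℂ => logMultipleGamma n z - (stirlingMain n z
        + ∑ r ∈ Finset.Icc 1 M,
            (bernoulli (2 * r) : ℂ) / ((2 * r).factorial : ℂ) * stirlingF n (2 * r - 1) z))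
      =ᶠ[sectorAtInfty δ] fun z => ∑ r ∈ Finset.Ico (2 * M + 1) m,
        (bernoulli (r + 1) : ℂ) / ((r + 1).factorial : ℂ) * stirlingF n r z - stirlingR n m z := by
    filter_upwards [eventually_mem_stirlingSector δ] with z hzs
    have hz := add_one_mem_slitPlane_of_mem_sector hδ hzs
    rw [logMultipleGamma_eq_main_add hn (show n < m by omega) hz,
      ← sum_bernoulli_mul_stirlingF hn M hz,
      ← Finset.sum_range_add_sum_Ico _ (show 2 * M + 1 ≤ m by omega)]
    ring
  refine hev.trans_isBigO (IsBigO.sub (IsBigO.fun_sum fun r hr => IsBigO.const_mul_left ?_ _) ?_)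
  · have := (Finset.mem_Ico.1 hr).1
    exact (isBigO_stirlingF hn r hδ).trans
      ((isBigO_norm_zpow_of_le (by omega)).mono (sectorAtInfty_le δ))
  · exact (isBigO_stirlingR hn (show n < m by omega) hδ hδ').trans
      ((isBigO_norm_zpow_of_le (by omega)).mono (sectorAtInfty_le δ))

theorem theorem3 :
    -- the multiple gamma functions exist and are unique
    IsMultipleGammaHierarchy multipleGamma ∧
    (∀ G : ℕ → ℂ → ℂ, IsMultipleGammaHierarchy G →
      ∀ n : ℕ, Set.EqOn (G n) (multipleGamma n) gammaDomain) ∧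
    ∀ n : ℕ, 1 ≤ n →
      ∃ L : ℂ → ℂ, IsLogMultipleGamma n L ∧
        ∀ δ : ℝ, 0 < δ → δ < Real.pi →
          -- `F_{n,r-1}(z) = O(z^(n-r))`
          (∀ r : ℕ, 1 ≤ r →
            stirlingF n (r - 1) =O[sectorAtInfty δ]
              fun z : ℂ => ‖z‖ ^ ((n : ℤ) - (r : ℤ))) ∧
          -- `R_{n,m}(z)` is well defined and `O(z^(n-m+1))`
          (∀ m : ℕ, n < m →
            (∀ z ∈ stirlingSector δ,
              MeasureTheory.IntegrableOn (stirlingRIntegrand n m z) (Set.Ioi (1 : ℝ))) ∧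
            stirlingR n m =O[sectorAtInfty δ]
              fun z : ℂ => ‖z‖ ^ ((n : ℤ) - (m : ℤ) + 1)) ∧
          -- the asymptotic expansion: truncated after `M` terms of the series, the error is of
          -- the order of the first omitted term
          (∀ M : ℕ,
            (fun z : ℂ => L z - (stirlingMain n z
                + ∑ r ∈ Finset.Icc 1 M,
                    (bernoulli (2 * r) : ℂ) / ((2 * r).factorial : ℂ)
                      * stirlingF n (2 * r - 1) z))
              =O[sectorAtInfty δ]
              fun z : ℂ => ‖z‖ ^ ((n : ℤ) - 2 * (M : ℤ) - 2)) := by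
  refine ⟨isMultipleGammaHierarchy_multipleGamma, fun G hG n z hz => ?_, fun n hn =>
    ⟨logMultipleGamma n, isLogMultipleGamma_logMultipleGamma n, fun δ hδ hδ' =>
      ⟨fun r hr => ?_, fun m hm => ⟨fun z hz => ?_, ?_⟩,
        fun M => isBigO_logMultipleGamma_sub hn M hδ hδ'⟩⟩⟩
  · exact (hG.eqOn_gammaHierarchy n hz).trans
      (isMultipleGammaHierarchy_multipleGamma.eqOn_gammaHierarchy n hz).symm
  · have h := isBigO_stirlingF hn (r - 1) hδ
    rwa [show (n : ℤ) - 1 - ((r - 1 : ℕ) : ℤ) = n - r by omega] at h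
  · exact integrableOn_stirlingRIntegrand hn hm (add_one_mem_slitPlane_of_mem_sector hδ hz)
  · exact isBigO_stirlingR hn hm hδ hδ'
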